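/- For $s\in\mathbb C$ off the (removable) singular points $1,0,-2,-4,\dots$ let $$\xi(s)=\frac{s(s-1)}{2}\,\pi^{-s/2}\,\Gamma(s/2)\,\zeta(s),$$ and for real $t$ let $\Xi(t)=\operatorname{Re}\xi(\tfrac12+it)$. For $x>0$ put $$\psi(x)=\sum_{n=1}^\infty e^{-n^2\pi x},\qquad D(x)=\sum_{n=1}^\infty n^2\left(n^2\pi x-\tfrac32\right)e^{-n^2\pi x},$$ and let $S(\omega)=8\pi e^{5\omega/2}D(e^{2\omega})$ for real $\omega$. (a) For all real $t$, $\xi(\tfrac12+it)=\Xi(t)$ (that is, $\xi$ is real on the critical line). Moreover $S(\omega)>0$ for all $\omega\ge 0$, $S$ is integrable on $(0,\infty)$, and $\Xi(t)=\int_0^\infty S(\omega)\cos(\omega t)\,d\omega$ for all real $t$. (b) The modulus of $\Xi$ is maximal at $t=0$: $|\Xi(t)|\le\Xi(0)$ for all real $t$, and $0.4971\le\Xi(0)<0.4972$. (c) $\Xi$ is integrable on $(0,\infty)$, and $$\int_0^\infty\Xi(t)\,dt=\frac{\pi}{2}S(0)=4\pi\left(\tfrac32\psi'(1)+\psi''(1)\right).$$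 Here $\psi$ is twice differentiable at $1$ with $$\psi(1)=\frac12\left(\frac{\pi^{1/4}}{\Gamma(3/4)}-1\right),\qquad \psi'(1)=-\frac18\,\frac{\pi^{1/4}}{\Gamma(3/4)},\qquad \psi''(1)=\pi^2\sum_{n=1}^\infty n^4e^{-\pi n^2},$$ so that $$\int_0^\infty\Xi(t)\,dt=4\pi^3\sum_{n=1}^\infty n^4e^{-\pi n^2}-\frac{3\pi}{4}\,\frac{\pi^{1/4}}{\Gamma(3/4)},$$ and this number equals $2.8067$ up to an error less than $5\cdot 10^{-5}$. -/

import Mathlib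

open MeasureTheory Set

namespace RiemannXi

/-- Riemann's `ξ(s) = (s(s-1)/2) π^{-s/2} Γ(s/2) ζ(s)`. The formula is used only on the critical
line; at `s = 1` and at the poles `s = 0, -2, -4, …` of `Γ(s/2)` it has to be completed by
continuity. -/
noncomputable def xi (s : ℂ) : ℂ :=
  s * (s - 1) / 2 * (Real.pi : ℂ) ^ (-s / 2) * Complex.Gamma (s / 2) * riemannZeta s

/-- `Ξ(t) = Re ξ(1/2 + it)`. -/
noncomputable def Xi (t : ℝ) : ℝ :=
  (xi (1 / 2 + Complex.I * (t : ℂ))).re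

/-- The theta function `ψ(x) = ∑_{n ≥ 1} exp(-n² π x)`, for `x > 0`. -/
noncomputable def psi (x : ℝ) : ℝ :=
  ∑' n : ℕ, Real.exp (-((n : ℝ) + 1) ^ 2 * Real.pi * x)

/-- `D(x) = ∑_{n ≥ 1} n² (n² π x - 3/2) exp(-n² π x)`, for `x > 0`. -/
noncomputable def D (x : ℝ) : ℝ :=
  ∑' n : ℕ, ((n : ℝ) + 1) ^ 2 * (((n : ℝ) + 1) ^ 2 * Real.pi * x - 3 / 2) *
    Real.exp (-((n : ℝ) + 1) ^ 2 * Real.pi * x)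

/-- The kernel `S(ω) = 8 π e^{5ω/2} D(e^{2ω})`. -/
noncomputable def S (ω : ℝ) : ℝ :=
  8 * Real.pi * Real.exp (5 * ω / 2) * D (Real.exp (2 * ω))

end RiemannXi

namespace RiemannXi

open Filter Topology Real

/-! The completed zeta function is a Mellin transform of `theta`. With `x = e^{2ω}`, the functional
equation folds it on the critical line into a real cosine transform of `f(ω) = e^{ω/2} ψ(e^{2ω})`,
so `Ξ(t) = 1/2 - 2(t² + 1/4) ∫ f cos(ωt)` (`xi_eq`). Two integrations by parts absorb the factor `t²
+ 1/4`, since `2(f'' - f/4) = S`. The boundary term cancels the constant because differentiating the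
functional equation at its fixed point gives `f'(0) = -1/4` (`psiK_one_one`, `Xi_eq_integral`).

Each term of `S` is positive for `ω ≥ 0`, as `n²πx > 3/2` there, hence `|Ξ(t)| ≤ Ξ(0)`. Two further
integrations by parts give `Ξ(t) = O(1/t²)`; thus `Ξ` is integrable and Fourier inversion at `0`
yields `π/2 * S(0)` (`integrable_Xi`, `integral_cosine_transform`).

The closed form of `theta 1` comes from Gauss: doubling `x` performs an arithmetic-geometric mean
step on `(theta x ^ 2, theta4 x ^ 2)`, with limit `1`, so the elliptic integral attached to the pair
at `x = 1` is `π` (`gaussI_theta`). By `theta4_one_pow_four` that integral is lemniscatic, hence a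
Gamma quotient.

Numerically, the series at `x = 1` are dominated by their first terms, and `Ξ(0)` reduces to an
incomplete Gamma integral enclosed by rational functions. -/

/-! ### Derivatives of `psi` and their decay. -/

/-- `∑_{n ≥ 1} (n² π)^k exp(-n² π x)`, which is `(-1)^k` times the `k`-th derivative of `psi`. -/
noncomputable def psiK (k : ℕ) (x : ℝ) : ℝ :=
  ∑' n : ℕ, (((n : ℝ) + 1) ^ 2 * π) ^ k * exp (-((n : ℝ) + 1) ^ 2 * π * x)

lemma summable_psiK (k : ℕ) {x : ℝ} (hx : 0 < x) :
    Summable fun n : ℕ => (((n : ℝ) + 1) ^ 2 * π) ^ k * exp (-((n : ℝ) + 1) ^ 2 * π * x) := by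
  have h := ((summable_nat_add_iff 1).mpr
    (summable_pow_mul_exp_neg_nat_mul (2 * k) (mul_pos pi_pos hx))).mul_left (π ^ k)
  refine h.of_nonneg_of_le (fun n => by positivity) fun n => ?_
  rw [mul_pow, ← pow_mul]
  push_cast
  have h1 : exp (-((n : ℝ) + 1) ^ 2 * π * x) ≤ exp (-(π * x) * ((n : ℝ) + 1)) := by
    apply exp_le_exp.mpr
    have : (0 : ℝ) ≤ n := n.cast_nonneg
    nlinarith [mul_nonneg (mul_pos pi_pos hx).le (by nlinarith : (0 : ℝ) ≤ (n + 1) ^ 2 - (n + 1))]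
  calc _ ≤ ((n : ℝ) + 1) ^ (2 * k) * π ^ k * exp (-(π * x) * ((n : ℝ) + 1)) := by gcongr
    _ = _ := by ring

lemma psiK_nonneg (k : ℕ) (x : ℝ) : 0 ≤ psiK k x := tsum_nonneg fun n => by positivity

lemma psi_eq_psiK : psi = psiK 0 := by
  funext x; simp [psi, psiK]

lemma hasDerivAt_psiK (k : ℕ) {x : ℝ} (hx : 0 < x) : HasDerivAt (psiK k) (-psiK (k + 1) x) x := by
  have h := hasDerivAt_tsum_of_isPreconnected (t := Ioi (x / 2)) (y₀ := x) (y := x)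
    (g := fun (n : ℕ) y => (((n : ℝ) + 1) ^ 2 * π) ^ k * exp (-((n : ℝ) + 1) ^ 2 * π * y))
    (g' := fun (n : ℕ) y =>
      -((((n : ℝ) + 1) ^ 2 * π) ^ (k + 1) * exp (-((n : ℝ) + 1) ^ 2 * π * y)))
    (summable_psiK (k + 1) (half_pos hx)) isOpen_Ioi isPreconnected_Ioi
    (fun n y _ => by
      have := (((hasDerivAt_id y).const_mul (-((n : ℝ) + 1) ^ 2 * π)).exp).const_mul
        ((((n : ℝ) + 1) ^ 2 * π) ^ k)
      refine this.congr_deriv ?_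
      simp only [id]
      ring)
    (fun n y hy => by
      have hy : x / 2 < y := hy
      rw [norm_neg, norm_of_nonneg (by positivity)]
      refine mul_le_mul_of_nonneg_left (exp_le_exp.mpr ?_) (by positivity)
      have : 0 ≤ ((n : ℝ) + 1) ^ 2 * π := by positivity
      nlinarith)
    (by simpa using half_lt_self hx) (summable_psiK k hx) (by simpa using half_lt_self hx)
  rw [tsum_neg] at h
  exact h

lemma psiK_le (k : ℕ) {x : ℝ} (hx : 1 ≤ x) : psiK k x ≤ exp 1 * psiK k 1 * exp (-x) := by
  have h : ∀ n : ℕ, (((n : ℝ) + 1) ^ 2 * π) ^ k * exp (-((n : ℝ) + 1) ^ 2 * π * x) ≤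
      exp 1 * exp (-x) * ((((n : ℝ) + 1) ^ 2 * π) ^ k * exp (-((n : ℝ) + 1) ^ 2 * π * 1)) := by
    intro n
    have h1 : (1 : ℝ) ≤ ((n : ℝ) + 1) ^ 2 * π := by
      have h0 : (0 : ℝ) ≤ n := n.cast_nonneg
      nlinarith [pi_gt_three]
    have h2 : exp (-((n : ℝ) + 1) ^ 2 * π * x) ≤
        exp 1 * exp (-x) * exp (-((n : ℝ) + 1) ^ 2 * π * 1) := by
      rw [← exp_add, ← exp_add, exp_le_exp]
      nlinarith [mul_nonneg (sub_nonneg.mpr h1) (sub_nonneg.mpr hx)]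
    calc _ ≤ (((n : ℝ) + 1) ^ 2 * π) ^ k *
        (exp 1 * exp (-x) * exp (-((n : ℝ) + 1) ^ 2 * π * 1)) := by gcongr
      _ = _ := by ring
  have h0 : (0 : ℝ) < x := by linarith
  calc psiK k x ≤ _ := (summable_psiK k h0).tsum_le_tsum h ((summable_psiK k one_pos).mul_left _)
    _ = exp 1 * exp (-x) * psiK k 1 := by rw [tsum_mul_left, psiK]
    _ = _ := by ring

/-- The functions `e^{aω} ψ_k(e^{2ω})`. -/
noncomputable def EK (a : ℝ) (k : ℕ) (ω : ℝ) : ℝ := exp (a * ω) * psiK k (exp (2 * ω))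

/-- The span of the `EK a k` is closed under differentiation, so decay and integrability need to be
proved only for this family. -/
lemma hasDerivAt_EK (a : ℝ) (k : ℕ) (ω : ℝ) :
    HasDerivAt (EK a k) (a * EK a k ω - 2 * EK (a + 2) (k + 1) ω) ω := by
  have h1 := ((hasDerivAt_id ω).const_mul a).exp
  have h2 := ((hasDerivAt_id ω).const_mul 2).exp
  have h3 := (hasDerivAt_psiK k (exp_pos (2 * ω))).comp ω h2
  refine (h1.mul h3).congr_deriv ?_
  simp only [EK, Function.comp, id, add_mul, exp_add]
  ring

lemma continuous_EK (a : ℝ) (k : ℕ) : Continuous (EK a k) :=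
  continuous_iff_continuousAt.mpr fun ω => (hasDerivAt_EK a k ω).continuousAt

lemma exists_EK_le (a : ℝ) (k : ℕ) : ∃ C, ∀ ω, 0 ≤ ω → ‖EK a k ω‖ ≤ C * exp (-ω) := by
  -- From `y ^ m / m! ≤ exp y` at `y = e^{2ω}`, the factor `exp (-y)` gains `e^{-2mω}`, and `m ≥ a +
  -- 1` makes `a - 2m ≤ -1` (with `m ≥ 0`).
  obtain ⟨m, hm⟩ := exists_nat_ge (a + 1)
  refine ⟨exp 1 * psiK k 1 * m.factorial, fun ω hω => ?_⟩
  have h1 : (1 : ℝ) ≤ exp (2 * ω) := one_le_exp (by linarith)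
  rw [EK, norm_of_nonneg (mul_nonneg (exp_pos _).le (psiK_nonneg _ _))]
  have h2 : exp (-exp (2 * ω)) ≤ m.factorial * exp (-(2 * m * ω)) := by
    have := pow_div_factorial_le_exp _ (exp_pos (2 * ω)).le m
    rw [div_le_iff₀ (by positivity), ← exp_nat_mul] at this
    rw [exp_neg, exp_neg, inv_le_iff_one_le_mul₀ (exp_pos _)]
    rw [show (2 * m * ω : ℝ) = m * (2 * ω) by ring]
    rw [mul_comm (m.factorial : ℝ), mul_assoc, ← div_eq_inv_mul, le_div_iff₀ (exp_pos _)]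
    linarith
  have h3 : exp (a * ω) * exp (-(2 * m * ω)) ≤ exp (-ω) := by
    rw [← exp_add, exp_le_exp]
    nlinarith [(Nat.cast_nonneg m : (0 : ℝ) ≤ m), mul_nonneg hω (sub_nonneg.mpr hm),
      mul_nonneg hω (Nat.cast_nonneg m : (0 : ℝ) ≤ m)]
  have h4 : 0 ≤ exp 1 * psiK k 1 := mul_nonneg (exp_pos _).le (psiK_nonneg _ _)
  calc exp (a * ω) * psiK k (exp (2 * ω))
      ≤ exp (a * ω) * (exp 1 * psiK k 1 * (m.factorial * exp (-(2 * m * ω)))) := by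
        gcongr
        exact (psiK_le k h1).trans (by gcongr)
    _ = exp 1 * psiK k 1 * m.factorial * (exp (a * ω) * exp (-(2 * m * ω))) := by ring
    _ ≤ _ := by gcongr

lemma integrableOn_EK (a : ℝ) (k : ℕ) : IntegrableOn (EK a k) (Ioi 0) := by
  obtain ⟨C, hC⟩ := exists_EK_le a k
  refine Integrable.mono' ((integrableOn_exp_neg_Ioi 0).const_mul C)
    (continuous_EK a k).aestronglyMeasurable ?_
  filter_upwards [ae_restrict_mem measurableSet_Ioi] with ω hω using hC ω (le_of_lt hω)

lemma tendsto_EK (a : ℝ) (k : ℕ) : Tendsto (EK a k) atTop (𝓝 0) := by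
  obtain ⟨C, hC⟩ := exists_EK_le a k
  have h : Tendsto (fun ω : ℝ => C * exp (-ω)) atTop (𝓝 0) := by
    simpa using (tendsto_exp_neg_atTop_nhds_zero).const_mul C
  refine squeeze_zero_norm' ?_ h
  filter_upwards [eventually_ge_atTop 0] with ω hω using hC ω hω

/-! ### The theta function, its functional equation and the derivatives at `1`. -/

/-- The theta function `∑_{n ∈ ℤ} exp(-n² π x)`, written in terms of `psi`. -/
noncomputable def theta (x : ℝ) : ℝ := 1 + 2 * psi x

lemma hasSum_theta {x : ℝ} (hx : 0 < x) :
    HasSum (fun n : ℤ => exp (-π * (n : ℝ) ^ 2 * x)) (theta x) := by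
  have h := (summable_psiK 0 hx).hasSum
  simp only [pow_zero, one_mul] at h
  have h1 : HasSum (fun n : ℕ => exp (-π * (((n : ℤ) + 1 : ℤ) : ℝ) ^ 2 * x)) (psi x) := by
    refine (h.congr_fun fun n => ?_ : HasSum _ (psi x))
    push_cast; ring_nf
  have h2 : HasSum (fun n : ℕ => exp (-π * ((-((n : ℤ) + 1) : ℤ) : ℝ) ^ 2 * x)) (psi x) := by
    refine (h.congr_fun fun n => ?_ : HasSum _ (psi x))
    push_cast; ring_nf
  convert! HasSum.of_add_one_of_neg_add_one
    (f := fun n : ℤ => exp (-π * (n : ℝ) ^ 2 * x)) h1 h2 using 1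
  simp [theta]; ring

/-- This identification imports the functional equation and the Mellin representation attached to
the Hurwitz kernel. -/
lemma evenKernel_zero {x : ℝ} (hx : 0 < x) : HurwitzZeta.evenKernel 0 x = theta x := by
  have h := HurwitzZeta.hasSum_int_evenKernel 0 hx
  simp only [add_zero] at h
  exact h.unique (hasSum_theta hx)

lemma theta_one_div {x : ℝ} (hx : 0 < x) : theta (1 / x) = x ^ (1 / 2 : ℝ) * theta x := by
  have h := HurwitzZeta.evenKernel_functional_equation 0 x
  rw [← HurwitzZeta.evenKernel_eq_cosKernel_of_zero, evenKernel_zero hx,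
    evenKernel_zero (one_div_pos.mpr hx)] at h
  rw [h]
  have := (rpow_pos_of_pos hx (1 / 2)).ne'
  field_simp

lemma theta_pos (x : ℝ) : 0 < theta x := by
  have := psiK_nonneg 0 x
  rw [theta, psi_eq_psiK]; linarith

lemma hasDerivAt_theta {x : ℝ} (hx : 0 < x) : HasDerivAt theta (-2 * psiK 1 x) x := by
  have := ((hasDerivAt_psiK 0 hx).const_mul 2).const_add 1
  unfold theta
  rw [psi_eq_psiK]
  exact this.congr_deriv (by ring)

/-- Differentiating the functional equation at `1` gives `θ'(1) = -θ(1) / 4`. -/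
lemma psiK_one_one : psiK 1 1 = theta 1 / 8 := by
  have h1 : HasDerivAt (fun x : ℝ => theta (1 / x)) (2 * psiK 1 1) 1 := by
    have h2 : HasDerivAt (fun x : ℝ => 1 / x) (-1) 1 := by
      simpa using (hasDerivAt_inv (one_ne_zero (α := ℝ)))
    have h3 : HasDerivAt theta (-2 * psiK 1 1) (1 / 1) := by
      simpa using hasDerivAt_theta one_pos
    exact (h3.comp (1 : ℝ) h2).congr_deriv (by ring)
  have h4 : HasDerivAt (fun x : ℝ => x ^ (1 / 2 : ℝ) * theta x)
      (1 / 2 * theta 1 + -2 * psiK 1 1) 1 := by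
    have := (Real.hasDerivAt_rpow_const (x := 1) (p := 1 / 2) (Or.inl one_ne_zero)).mul
      (hasDerivAt_theta one_pos)
    exact this.congr_deriv (by simp)
  have h5 := h1.unique (h4.congr_of_eventuallyEq
    ((eventually_gt_nhds one_pos).mono fun x hx => theta_one_div hx))
  linarith

lemma hasDerivAt_psi_one : HasDerivAt psi (-(1 / 8) * theta 1) 1 := by
  rw [psi_eq_psiK]
  refine (hasDerivAt_psiK 0 one_pos).congr_deriv ?_
  rw [psiK_one_one]; ring

lemma hasDerivAt_deriv_psi {x : ℝ} (hx : 0 < x) : HasDerivAt (deriv psi) (psiK 2 x) x := by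
  have h : HasDerivAt (fun x => -psiK 1 x) (psiK 2 x) x :=
    (hasDerivAt_psiK 1 hx).neg.congr_deriv (by ring)
  refine h.congr_of_eventuallyEq ((eventually_gt_nhds hx).mono fun y hy => ?_)
  rw [psi_eq_psiK]
  exact (hasDerivAt_psiK 0 hy).deriv

lemma psiK_two_one : psiK 2 1 =
    π ^ 2 * ∑' n : ℕ, ((n : ℝ) + 1) ^ 4 * exp (-π * ((n : ℝ) + 1) ^ 2) := by
  rw [psiK, ← tsum_mul_left]
  congr 1 with n
  rw [show -((n : ℝ) + 1) ^ 2 * π * 1 = -π * ((n : ℝ) + 1) ^ 2 by ring]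
  ring

/-! ### The integral representation of `Ξ` in terms of `psi` -/

/-- The completed zeta function as a Mellin transform, in the variable `ω` with `x = e^{2ω}`. -/
lemma completedRiemannZeta₀_eq (t : ℝ) :
    completedRiemannZeta₀ (1 / 2 + Complex.I * t) =
      ((4 * ∫ ω in Ioi (0 : ℝ), EK (1 / 2) 0 ω * cos (ω * t) : ℝ) : ℂ) := by
  set P := HurwitzZeta.hurwitzEvenFEPair 0 with hP
  set s : ℂ := (1 / 2 + Complex.I * t) / 2 with hs
  -- The entire completed zeta function is defined as half the Mellin transform, at half the
  -- argument, of the kernel with its growing parts removed.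
  have h0 : completedRiemannZeta₀ (1 / 2 + Complex.I * t) = mellin P.f_modif s / 2 := rfl
  set g : ℝ → ℂ := fun ω => 2 * Complex.exp (2 * ω * s) * P.f_modif (exp (2 * ω)) with hg
  have himg : (fun ω : ℝ => exp (2 * ω)) '' univ = Ioi 0 := by
    ext x
    simp only [image_univ, mem_range, mem_Ioi]
    refine ⟨?_, fun hx => ⟨log x / 2, ?_⟩⟩
    · rintro ⟨y, rfl⟩; exact exp_pos _
    · rw [mul_div_cancel₀ _ (two_ne_zero), exp_log hx]
  have h1 : mellin P.f_modif s = ∫ ω, g ω := by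
    rw [mellin, ← himg, integral_image_eq_integral_abs_deriv_smul MeasurableSet.univ
      (f' := fun ω => exp (2 * ω) * 2)
      (fun ω _ => HasDerivAt.hasDerivWithinAt (by
        simpa using (((hasDerivAt_id ω).const_mul 2).exp)))
      (fun x _ y _ hxy => by simpa using hxy)]
    rw [setIntegral_univ]
    congr 1 with ω
    rw [abs_of_pos (by positivity), Complex.real_smul, smul_eq_mul, hg]
    have h2 : ((exp (2 * ω) : ℝ) : ℂ) ^ (s - 1) = Complex.exp (2 * ω * s) / Complex.exp (2 * ω) := by
      rw [Complex.ofReal_exp, Complex.cpow_def_of_ne_zero (Complex.exp_ne_zero _),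
        ← Complex.ofReal_exp, ← Complex.ofReal_log (exp_pos _).le, log_exp, ← Complex.exp_sub]
      push_cast
      ring_nf
    rw [h2]
    push_cast
    have := Complex.exp_ne_zero (2 * ω)
    field_simp
  -- For `x > 1` the modified kernel is `theta x - 1 = 2 * psi x`.
  have hgpos : ∀ ω, 0 < ω → g ω = 4 * (EK (1 / 2) 0 ω * Complex.exp (Complex.I * (ω * t))) := by
    intro ω hω
    have h1 : (1 : ℝ) < exp (2 * ω) := one_lt_exp_iff.mpr (by linarith)
    have h2 : P.f_modif (exp (2 * ω)) = 2 * psi (exp (2 * ω)) := by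
      rw [WeakFEPair.f_modif, Pi.add_apply, indicator_of_mem (mem_Ioi.mpr h1),
        indicator_of_notMem (notMem_Ioo_of_ge h1.le), add_zero]
      simp only [hP, HurwitzZeta.hurwitzEvenFEPair, Function.comp, if_true,
        evenKernel_zero (exp_pos (2 * ω)), theta]
      push_cast; ring
    rw [hg]
    simp only []
    rw [h2, EK, psi_eq_psiK, show (2 * ω * s : ℂ) = ((1 / 2 * ω : ℝ) : ℂ) + Complex.I * (ω * t) by
      rw [hs]; push_cast; ring, Complex.exp_add]
    push_cast; ring
  -- The pair is self-dual, so `x ↦ 1/x` multiplies the modified kernel by `x^{1/2}`. On the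
  -- critical line this only conjugates the phase, and adding `ω` and `-ω` produces a cosine.
  have hgneg : ∀ ω, 0 < ω → g (-ω) = 4 * (EK (1 / 2) 0 ω * Complex.exp (-Complex.I * (ω * t))) := by
    intro ω hω
    have h1 := P.hf_modif_FE (exp (2 * ω)) (exp_pos _)
    have hgm : P.g_modif = P.f_modif := by
      have : P.symm = P := HurwitzZeta.hurwitzEvenFEPair_zero_symm
      change P.symm.f_modif = _
      rw [this]
    have h2 := hgpos ω hω
    rw [hgm, one_div, ← exp_neg] at h1
    have hk : exp (2 * ω) ^ P.k = exp ω := by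
      change exp (2 * ω) ^ (1 / 2 : ℝ) = _
      rw [← exp_mul]; ring_nf
    have hε : P.ε = 1 := rfl
    have h3 : g (-ω) = Complex.exp (ω - 4 * ω * s) * g ω := by
      simp only [hg]
      rw [show (2 * -ω : ℝ) = -(2 * ω) by ring, h1, hk, hε]
      push_cast
      rw [smul_eq_mul, one_mul, show (2 * -ω * s : ℂ) = -ω + ((ω - 4 * ω * s) + 2 * ω * s) by ring,
        Complex.exp_add, Complex.exp_add, Complex.exp_neg]
      have := Complex.exp_ne_zero ω
      field_simp
    rw [h3, h2, show (ω - 4 * ω * s : ℂ) = -Complex.I * (ω * t) + - (Complex.I * (ω * t)) by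
      rw [hs]; ring, Complex.exp_add, Complex.exp_neg (Complex.I * _)]
    have := Complex.exp_ne_zero (Complex.I * (ω * t))
    field_simp
  have hint : ∀ c : ℂ, c.re = 0 →
      IntegrableOn (fun ω : ℝ => 4 * (EK (1 / 2) 0 ω * Complex.exp (c * (ω * t)))) (Ioi 0) := by
    intro c hc
    refine Integrable.mono' (((integrableOn_EK (1 / 2) 0).norm).const_mul 4) ?_ ?_
    · have := continuous_EK (1 / 2) 0
      exact Continuous.aestronglyMeasurable (by fun_prop)
    · refine Eventually.of_forall fun ω => ?_
      rw [norm_mul, norm_mul, Complex.norm_exp, Complex.norm_real]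
      simp [hc]
  have i1 : IntegrableOn g (Ioi 0) :=
    (hint Complex.I (by simp)).congr_fun (fun ω hω => (hgpos ω hω).symm) measurableSet_Ioi
  have i2 : IntegrableOn (fun ω => g (-ω)) (Ioi 0) :=
    (hint (-Complex.I) (by simp)).congr_fun (fun ω hω => (hgneg ω hω).symm) measurableSet_Ioi
  have i3 : IntegrableOn g (Iic 0) := by
    have h := (integrableOn_Ici_iff_integrableOn_Ioi (by simp)).mpr i2
    rw [← neg_zero] at h
    simpa using h.comp_neg_Iic
  have h4 : ∫ ω, g ω = ∫ ω in Ioi (0 : ℝ), (g (-ω) + g ω) := by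
    rw [integral_add i2 i1, integral_comp_neg_Ioi, neg_zero,
      intervalIntegral.integral_Iic_add_Ioi i3 i1]
  rw [h0, h1, h4, ← integral_const_mul, ← integral_complex_ofReal, ← integral_div]
  refine setIntegral_congr_fun measurableSet_Ioi fun ω hω => ?_
  rw [hgpos ω hω, hgneg ω hω]
  push_cast
  rw [Complex.cos]
  ring_nf

lemma xi_eq (t : ℝ) : xi (1 / 2 + Complex.I * t) =
    ((1 / 2 - 2 * (t ^ 2 + 1 / 4) * ∫ ω in Ioi (0 : ℝ), EK (1 / 2) 0 ω * cos (ω * t) : ℝ) : ℂ) := by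
  have h0 := completedRiemannZeta₀_eq t
  set s : ℂ := 1 / 2 + Complex.I * t with hs
  have hre : s.re = 1 / 2 := by simp [hs]
  have hs0 : s ≠ 0 := fun h => by simp [h] at hre
  have hs1 : 1 - s ≠ 0 := fun h => by
    have : s = 1 := (sub_eq_zero.mp h).symm
    rw [this] at hre; norm_num at hre
  have hG : (π : ℂ) ^ (-s / 2) * Complex.Gamma (s / 2) ≠ 0 := by
    have := Complex.Gammaℝ_ne_zero_of_re_pos (s := s) (by rw [hre]; norm_num)
    rwa [Complex.Gammaℝ] at this
  -- The two pole terms add up to `-1 / (s (1 - s))`, which contributes the constant `1/2`.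
  have h1 : xi s = s * (s - 1) / 2 * completedRiemannZeta₀ s + 1 / 2 := by
    rw [xi, riemannZeta_eq_completedRiemannZeta₀ hs0]
    have : s * (s - 1) / 2 * (π : ℂ) ^ (-s / 2) * Complex.Gamma (s / 2) *
        ((completedRiemannZeta₀ s - 1 / s - 1 / (1 - s)) /
          ((π : ℂ) ^ (-s / 2) * Complex.Gamma (s / 2))) =
        s * (s - 1) / 2 * (completedRiemannZeta₀ s - 1 / s - 1 / (1 - s)) := by
      generalize completedRiemannZeta₀ s - 1 / s - 1 / (1 - s) = z
      rw [show s * (s - 1) / 2 * (π : ℂ) ^ (-s / 2) * Complex.Gamma (s / 2) =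
        s * (s - 1) / 2 * ((π : ℂ) ^ (-s / 2) * Complex.Gamma (s / 2)) by ring,
        mul_assoc, mul_div_cancel₀ _ hG]
    rw [this]
    field_simp
    ring
  have h2 : s * (s - 1) = -((t : ℂ) ^ 2 + 1 / 4) := by
    rw [hs]; linear_combination (t : ℂ) ^ 2 * Complex.I_sq
  rw [h1, h2, h0]
  push_cast
  ring

lemma Xi_eq (t : ℝ) : Xi t =
    1 / 2 - 2 * (t ^ 2 + 1 / 4) * ∫ ω in Ioi (0 : ℝ), EK (1 / 2) 0 ω * cos (ω * t) := by
  rw [Xi, xi_eq, Complex.ofReal_re]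

/-! ### Cosine transforms -/

lemma integrableOn_mul_cos {f : ℝ → ℝ} (hf : IntegrableOn f (Ioi 0)) (t : ℝ) :
    IntegrableOn (fun ω => f ω * cos (ω * t)) (Ioi 0) := by
  refine Integrable.mono' hf.norm (hf.aestronglyMeasurable.mul
    (Continuous.aestronglyMeasurable (by fun_prop))) (Eventually.of_forall fun ω => ?_)
  rw [norm_mul]
  exact mul_le_of_le_one_right (norm_nonneg _) (abs_cos_le_one _)

lemma norm_integral_mul_cos_le (f : ℝ → ℝ) (hf : IntegrableOn f (Ioi 0)) (t : ℝ) :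
    |∫ ω in Ioi (0 : ℝ), f ω * cos (ω * t)| ≤ ∫ ω in Ioi (0 : ℝ), |f ω| := by
  rw [← norm_eq_abs]
  refine norm_integral_le_of_norm_le (g := fun ω => |f ω|) hf.norm (Eventually.of_forall fun ω => ?_)
  rw [norm_mul]
  exact mul_le_of_le_one_right (norm_nonneg _) (abs_cos_le_one _)

lemma continuous_integral_mul_cos {f : ℝ → ℝ} (hf : IntegrableOn f (Ioi 0)) :
    Continuous fun t => ∫ ω in Ioi (0 : ℝ), f ω * cos (ω * t) := by
  refine continuous_of_dominated (fun t => (integrableOn_mul_cos hf t).aestronglyMeasurable)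
    (fun t => Eventually.of_forall fun ω => ?_) hf.norm (Eventually.of_forall fun ω => by fun_prop)
  rw [norm_mul]
  exact mul_le_of_le_one_right (norm_nonneg _) (abs_cos_le_one _)

/-- Integrating a cosine transform by parts twice. -/
lemma sq_mul_integral_mul_cos {f f' f'' : ℝ → ℝ} (hf : ∀ x, HasDerivAt f (f' x) x)
    (hf' : ∀ x, HasDerivAt f' (f'' x) x) (i0 : IntegrableOn f (Ioi 0))
    (i2 : IntegrableOn f'' (Ioi 0)) (l0 : Tendsto f atTop (𝓝 0)) (l1 : Tendsto f' atTop (𝓝 0))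
    (t : ℝ) : t ^ 2 * (∫ ω in Ioi (0 : ℝ), f ω * cos (ω * t)) =
      -f' 0 - ∫ ω in Ioi (0 : ℝ), f'' ω * cos (ω * t) := by
  -- Both integrations by parts in one antiderivative; at `0` the sine vanishes and only `f' 0`
  -- survives.
  have hd : ∀ x ∈ Ici (0 : ℝ), HasDerivAt (fun ω => t * (f ω * sin (ω * t)) + f' ω * cos (ω * t))
      (t ^ 2 * (f x * cos (x * t)) + f'' x * cos (x * t)) x := by
    intro x _
    have hx : HasDerivAt (fun ω : ℝ => ω * t) t x := by
      simpa using (hasDerivAt_id x).mul_const t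
    refine ((((hf x).mul hx.sin).const_mul t).add ((hf' x).mul hx.cos)).congr_deriv ?_
    ring
  have j0 := (integrableOn_mul_cos i0 t).const_mul (t ^ 2)
  have j2 := integrableOn_mul_cos i2 t
  have hl : Tendsto (fun ω => t * (f ω * sin (ω * t)) + f' ω * cos (ω * t)) atTop (𝓝 0) := by
    have a1 : Tendsto (fun ω => f ω * sin (ω * t)) atTop (𝓝 0) := by
      refine squeeze_zero_norm (fun ω => ?_) (by simpa using l0.norm)
      rw [norm_mul]
      exact mul_le_of_le_one_right (norm_nonneg _) (abs_sin_le_one _)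
    have a2 : Tendsto (fun ω => f' ω * cos (ω * t)) atTop (𝓝 0) := by
      refine squeeze_zero_norm (fun ω => ?_) (by simpa using l1.norm)
      rw [norm_mul]
      exact mul_le_of_le_one_right (norm_nonneg _) (abs_cos_le_one _)
    simpa using (a1.const_mul t).add a2
  have h := integral_Ioi_of_hasDerivAt_of_tendsto' hd (j0.add j2) hl
  rw [integral_add j0 j2, integral_const_mul] at h
  simp only [zero_mul, sin_zero, mul_zero, cos_zero, mul_one, zero_add, zero_sub] at h
  linarith

lemma integral_even (f : ℝ → ℝ) (hf : ∀ t, f (-t) = f t) :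
    ∫ t, f t = 2 * ∫ t in Ioi (0 : ℝ), f t := by
  rw [← integral_comp_abs]
  congr 1 with t
  rcases abs_choice t with h | h <;> simp [h, hf]

/-- Fourier inversion at `0` for cosine transforms. -/
lemma integral_cosine_transform {f X : ℝ → ℝ} (hc : Continuous f) (hf : IntegrableOn f (Ioi 0))
    (hX : ∀ t, X t = ∫ ω in Ioi (0 : ℝ), f ω * cos (ω * t)) (hXi : Integrable X) :
    ∫ t in Ioi (0 : ℝ), X t = π / 2 * f 0 := by
  -- The even extension is continuous at `0`, so pointwise inversion there recovers `f 0`.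
  set F : ℝ → ℂ := fun ω => (f |ω| : ℂ) with hF
  have hFc : Continuous F := by fun_prop
  have hFpos : IntegrableOn F (Ioi 0) :=
    Integrable.congr (Integrable.ofReal hf) ((ae_restrict_mem measurableSet_Ioi).mono fun ω hω => by
      simp [hF, abs_of_pos hω.out])
  have hFneg : IntegrableOn F (Iic 0) := by
    have h := (integrableOn_Ici_iff_integrableOn_Ioi (by simp)).mpr hFpos
    rw [← neg_zero] at h
    simpa [hF] using h.comp_neg_Iic
  have hFi : Integrable F := by
    rw [← integrableOn_univ, ← Iic_union_Ioi (a := (0 : ℝ))]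
    exact hFneg.union hFpos
  have hFT : FourierTransform.fourier F = fun ξ => ((2 * X (2 * π * ξ) : ℝ) : ℂ) := by
    funext ξ
    rw [Real.fourier_real_eq_integral_exp_smul]
    set g : ℝ → ℂ := fun v => Complex.exp (↑(-2 * π * v * ξ) * Complex.I) • F v with hg
    have hgi : Integrable g := by
      refine hFi.norm.mono' (Continuous.aestronglyMeasurable (by fun_prop))
        (Eventually.of_forall fun v => ?_)
      rw [hg, norm_smul, Complex.norm_exp_ofReal_mul_I, one_mul]
    have h1 : ∫ v, g v = ∫ v in Ioi (0 : ℝ), (g (-v) + g v) := by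
      rw [integral_add hgi.comp_neg.integrableOn hgi.integrableOn, integral_comp_neg_Ioi, neg_zero,
        intervalIntegral.integral_Iic_add_Ioi hgi.integrableOn hgi.integrableOn]
    rw [h1, hX, ← integral_const_mul, ← integral_complex_ofReal]
    refine setIntegral_congr_fun measurableSet_Ioi fun v hv => ?_
    simp only [hg, hF, abs_neg, abs_of_pos hv.out, smul_eq_mul]
    push_cast
    rw [Complex.cos]
    ring_nf
  have hXs : Integrable fun ξ => 2 * X (2 * π * ξ) :=
    (hXi.comp_mul_left' (by positivity : 2 * π ≠ 0)).const_mul 2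
  have hinv := hFi.fourierInv_fourier_eq (by rw [hFT]; exact hXs.ofReal) (v := 0)
    hFc.continuousAt
  rw [Real.fourierInv_eq, hFT] at hinv
  simp only [inner_zero_right, AddChar.map_zero_eq_one, one_smul, hF, abs_zero] at hinv
  rw [integral_complex_ofReal, Complex.ofReal_inj, integral_const_mul,
    Measure.integral_comp_mul_left X (2 * π)] at hinv
  rw [← hinv, integral_even X (fun t => by simp [hX]), abs_of_pos (by positivity), smul_eq_mul]
  field_simp

/-! ### The kernel -/

lemma D_eq {x : ℝ} (hx : 0 < x) : D x = (x * psiK 2 x - 3 / 2 * psiK 1 x) / π := by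
  have h := (((summable_psiK 2 hx).hasSum.mul_left x).sub
    ((summable_psiK 1 hx).hasSum.mul_left (3 / 2))).div_const π
  rw [D]
  refine (h.congr_fun fun n => ?_).tsum_eq
  field_simp

lemma S_eq (ω : ℝ) : S ω = 8 * EK (9 / 2) 2 ω - 12 * EK (5 / 2) 1 ω := by
  rw [S, D_eq (exp_pos _), EK, EK, show 9 / 2 * ω = 5 * ω / 2 + 2 * ω by ring, exp_add,
    show 5 / 2 * ω = 5 * ω / 2 by ring]
  field_simp
  ring

lemma S_pos {ω : ℝ} (hω : 0 ≤ ω) : 0 < S ω := by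
  have hx : (1 : ℝ) ≤ exp (2 * ω) := one_le_exp (by linarith)
  have hx0 : (0 : ℝ) < exp (2 * ω) := exp_pos _
  rw [S]
  refine mul_pos (by positivity) ?_
  have hpos : ∀ n : ℕ, 0 < ((n : ℝ) + 1) ^ 2 * (((n : ℝ) + 1) ^ 2 * π * exp (2 * ω) - 3 / 2) *
      exp (-((n : ℝ) + 1) ^ 2 * π * exp (2 * ω)) := by
    intro n
    have h1 : (1 : ℝ) ≤ ((n : ℝ) + 1) ^ 2 := by
      have : (0 : ℝ) ≤ n := n.cast_nonneg
      nlinarith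
    have h2 : (3 : ℝ) < ((n : ℝ) + 1) ^ 2 * π := by nlinarith [pi_gt_three]
    have h3 : (3 : ℝ) < ((n : ℝ) + 1) ^ 2 * π * exp (2 * ω) := by nlinarith
    have : 0 < ((n : ℝ) + 1) ^ 2 * π * exp (2 * ω) - 3 / 2 := by linarith
    positivity
  have h := (((summable_psiK 2 hx0).mul_left (exp (2 * ω))).sub
    ((summable_psiK 1 hx0).mul_left (3 / 2))).div_const π
  rw [D]
  refine Summable.tsum_pos (h.congr fun n => ?_) (fun n => (hpos n).le) 0 (hpos 0)
  field_simp

lemma continuous_S : Continuous S := by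
  have := continuous_EK (9 / 2) 2
  have := continuous_EK (5 / 2) 1
  rw [funext S_eq]; fun_prop

lemma integrableOn_S : IntegrableOn S (Ioi 0) := by
  rw [funext S_eq]
  exact ((integrableOn_EK _ _).const_mul _).sub ((integrableOn_EK _ _).const_mul _)

/-- With `f = EK (1 / 2) 0` one has `f'' = S/2 + f/4` and `f'(0) = -1/4`, so integration by parts
gives `2(t² + 1/4) ∫ f cos = 1/2 - ∫ S cos`. -/
lemma Xi_eq_integral (t : ℝ) : Xi t = ∫ ω in Ioi (0 : ℝ), S ω * cos (ω * t) := by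
  have h := sq_mul_integral_mul_cos (f := EK (1 / 2) 0)
    (f' := fun x => 1 / 2 * EK (1 / 2) 0 x - 2 * EK (5 / 2) 1 x)
    (f'' := fun x => 1 / 2 * S x + 1 / 4 * EK (1 / 2) 0 x)
    (fun x => (hasDerivAt_EK _ _ x).congr_deriv (by norm_num))
    (fun x => (((hasDerivAt_EK _ _ x).const_mul _).sub
      ((hasDerivAt_EK _ _ x).const_mul _)).congr_deriv (by rw [S_eq]; norm_num; ring))
    (integrableOn_EK _ _) ((integrableOn_S.const_mul _).add ((integrableOn_EK _ _).const_mul _))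
    (tendsto_EK _ _)
    (by simpa only [mul_zero, sub_zero] using ((tendsto_EK (1 / 2) 0).const_mul (1 / 2 : ℝ)).sub
          ((tendsto_EK (5 / 2) 1).const_mul (2 : ℝ))) t
  have h1 : ∫ ω in Ioi (0 : ℝ), (1 / 2 * S ω + 1 / 4 * EK (1 / 2) 0 ω) * cos (ω * t) =
      1 / 2 * (∫ ω in Ioi (0 : ℝ), S ω * cos (ω * t)) +
      1 / 4 * ∫ ω in Ioi (0 : ℝ), EK (1 / 2) 0 ω * cos (ω * t) := by
    rw [← integral_const_mul, ← integral_const_mul,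
      ← integral_add ((integrableOn_mul_cos integrableOn_S t).const_mul _)
        ((integrableOn_mul_cos (integrableOn_EK _ _) t).const_mul _)]
    congr 1 with ω
    ring
  have h2 : 1 / 2 * EK (1 / 2) 0 0 - 2 * EK (5 / 2) 1 0 = -1 / 4 := by
    simp only [EK, mul_zero, exp_zero, one_mul, psiK_one_one, theta, psi_eq_psiK]
    ring
  rw [h1, h2] at h
  rw [Xi_eq]
  linarith

lemma abs_Xi_le (t : ℝ) : |Xi t| ≤ Xi 0 := by
  rw [Xi_eq_integral, Xi_eq_integral]
  refine (norm_integral_mul_cos_le S integrableOn_S t).trans_eq ?_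
  refine setIntegral_congr_fun measurableSet_Ioi fun ω hω => ?_
  simp [abs_of_pos (S_pos (le_of_lt hω.out))]

/-- `S1` and `S2` are the first two derivatives of `S`. Parts twice bounds `t² |Ξ(t)|`, and with
`|Ξ| ≤ Ξ(0)` this dominates `Ξ` by a multiple of `1/(1 + t²)`. -/
lemma integrable_Xi : Integrable Xi := by
  set S1 : ℝ → ℝ := fun ω => 60 * EK (9 / 2) 2 ω - 16 * EK (13 / 2) 3 ω - 30 * EK (5 / 2) 1 ω
  set S2 : ℝ → ℝ := fun ω => 330 * EK (9 / 2) 2 ω - 224 * EK (13 / 2) 3 ω - 75 * EK (5 / 2) 1 ω +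
    32 * EK (17 / 2) 4 ω
  have d0 : ∀ x, HasDerivAt S (S1 x) x := fun x => by
    rw [funext S_eq]
    exact (((hasDerivAt_EK _ _ x).const_mul _).sub
      ((hasDerivAt_EK _ _ x).const_mul _)).congr_deriv (by norm_num [S1]; ring)
  have d1 : ∀ x, HasDerivAt S1 (S2 x) x := fun x =>
    ((((hasDerivAt_EK _ _ x).const_mul _).sub ((hasDerivAt_EK _ _ x).const_mul _)).sub
      ((hasDerivAt_EK _ _ x).const_mul _)).congr_deriv (by norm_num [S2]; ring)
  have i2 : IntegrableOn S2 (Ioi 0) :=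
    ((((integrableOn_EK _ _).const_mul _).sub ((integrableOn_EK _ _).const_mul _)).sub
      ((integrableOn_EK _ _).const_mul _)).add ((integrableOn_EK _ _).const_mul _)
  have l0 : Tendsto S atTop (𝓝 0) := by
    rw [funext S_eq]
    simpa using ((tendsto_EK (9 / 2) 2).const_mul 8).sub ((tendsto_EK (5 / 2) 1).const_mul 12)
  have l1 : Tendsto S1 atTop (𝓝 0) := by
    simpa using (((tendsto_EK (9 / 2) 2).const_mul 60).sub
      ((tendsto_EK (13 / 2) 3).const_mul 16)).sub ((tendsto_EK (5 / 2) 1).const_mul 30)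
  have hc : Continuous Xi := by
    rw [funext Xi_eq_integral]
    exact continuous_integral_mul_cos integrableOn_S
  refine (integrable_inv_one_add_sq.const_mul
    (Xi 0 + (|S1 0| + ∫ ω in Ioi (0 : ℝ), |S2 ω|))).mono' hc.aestronglyMeasurable
    (Eventually.of_forall fun t => ?_)
  have h := sq_mul_integral_mul_cos d0 d1 integrableOn_S i2 l0 l1 t
  rw [← Xi_eq_integral] at h
  have h1 : t ^ 2 * |Xi t| ≤ |S1 0| + ∫ ω in Ioi (0 : ℝ), |S2 ω| := by
    rw [← abs_of_nonneg (sq_nonneg t), ← abs_mul, h]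
    refine (abs_sub _ _).trans ?_
    rw [abs_neg]
    gcongr
    exact norm_integral_mul_cos_le S2 i2 t
  rw [← div_eq_mul_inv, le_div_iff₀ (by positivity), norm_eq_abs]
  linarith [abs_Xi_le t]

lemma integral_Xi : ∫ t in Ioi (0 : ℝ), Xi t = π / 2 * S 0 :=
  integral_cosine_transform continuous_S integrableOn_S Xi_eq_integral integrable_Xi

lemma S_zero : S 0 = 8 * psiK 2 1 - 12 * psiK 1 1 := by
  simp [S_eq, EK]

/-! ### The elliptic integral -/

/-- The substitution `t = (x - p / x) / 2` in an elliptic integral. -/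
lemma integral_ellipticK_subst (s : ℝ) {p : ℝ} (hp : 0 < p) :
    ∫ t : ℝ, 1 / √((t ^ 2 + (s + 2 * p) / 4) * (t ^ 2 + p)) =
      2 * ∫ x in Ioi (0 : ℝ), 1 / √(x ^ 4 + s * x ^ 2 + p ^ 2) := by
  have himg : (fun x : ℝ => (x - p / x) / 2) '' Ioi 0 = univ := by
    -- The witness is the positive root of `x² - 2tx - p = 0`.
    refine eq_univ_of_forall fun t => ⟨t + √(t ^ 2 + p), ?_, ?_⟩
    · have : |t| < √(t ^ 2 + p) := by
        rw [← sqrt_sq_eq_abs]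
        exact sqrt_lt_sqrt (sq_nonneg t) (by linarith)
      have := neg_abs_le t
      simp only [mem_Ioi]; linarith
    · have h1 : |t| < √(t ^ 2 + p) := by
        rw [← sqrt_sq_eq_abs]
        exact sqrt_lt_sqrt (sq_nonneg t) (by linarith)
      have h2 := neg_abs_le t
      have h3 : t + √(t ^ 2 + p) ≠ 0 := by linarith
      have h4 : √(t ^ 2 + p) ^ 2 = t ^ 2 + p := sq_sqrt (by positivity)
      simp only []
      field_simp
      linear_combination h4
  rw [← setIntegral_univ, ← himg, integral_image_eq_integral_abs_deriv_smul measurableSet_Ioi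
    (f' := fun x => (1 + p / x ^ 2) / 2)]
  · rw [← integral_const_mul]
    refine setIntegral_congr_fun measurableSet_Ioi fun x hx => ?_
    have hx : 0 < x := hx
    -- Since `t² + p = ((x + p/x)/2)²`, the square root yields a factor that cancels the Jacobian up
    -- to `2`.
    have h1 : (((x - p / x) / 2) ^ 2 + (s + 2 * p) / 4) * (((x - p / x) / 2) ^ 2 + p) =
        (x ^ 4 + s * x ^ 2 + p ^ 2) * ((x ^ 2 + p) / (4 * x ^ 2)) ^ 2 := by
      field_simp
      ring
    simp only [smul_eq_mul]
    rw [h1, sqrt_mul' _ (sq_nonneg _), sqrt_sq (by positivity), abs_of_pos (by positivity)]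
    have : x ^ 2 + p ≠ 0 := by positivity
    rw [one_div, mul_inv]
    field_simp
    ring
  · intro x hx
    have hx : x ≠ 0 := ne_of_gt hx
    have h := ((hasDerivAt_id x).sub ((hasDerivAt_inv hx).const_mul p)).div_const 2
    refine HasDerivAt.hasDerivWithinAt (h.congr_deriv ?_)
    field_simp
    ring
  · intro x hx y hy hxy
    have hx : 0 < x := hx
    have hy : 0 < y := hy
    simp only [] at hxy
    field_simp at hxy
    have h2 : (x - y) * (x * y + p) = 0 := by linear_combination hxy
    rcases mul_eq_zero.mp h2 with h | h
    · linarith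
    · nlinarith [mul_pos hx hy]

/-- A complete elliptic integral of the first kind, in Gauss's symmetric form. -/
noncomputable def gaussI (a b : ℝ) : ℝ := ∫ t : ℝ, 1 / √((t ^ 2 + a ^ 2) * (t ^ 2 + b ^ 2))

/-- Gauss's theorem: the elliptic integral is invariant under the arithmetic-geometric mean step. -/
lemma gaussI_agm {a b a' b' : ℝ} (ha : 0 < a) (hb : 0 < b) (ha' : 2 * a' = a + b)
    (hb' : b' ^ 2 = a * b) : gaussI a' b' = gaussI a b := by
  -- Taking `s = a² + b²` and `p = ab`, the quartic of the substitution factors as `(x² + a²)(x² +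
  -- b²)`.
  have h1 : ∀ t : ℝ, (t ^ 2 + a' ^ 2) * (t ^ 2 + b' ^ 2) =
      (t ^ 2 + ((a ^ 2 + b ^ 2) + 2 * (a * b)) / 4) * (t ^ 2 + a * b) := fun t => by
    rw [hb', show a' = (a + b) / 2 by linarith]; ring
  rw [gaussI, gaussI]
  simp_rw [h1]
  rw [integral_ellipticK_subst _ (mul_pos ha hb),
    integral_even (fun t => 1 / √((t ^ 2 + a ^ 2) * (t ^ 2 + b ^ 2))) (fun t => by simp)]
  congr 2 with x
  ring_nf

lemma integrable_one_div_sq_add_sq {m : ℝ} (hm : 0 < m) :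
    Integrable fun t : ℝ => 1 / (t ^ 2 + m ^ 2) := by
  have h := (integrable_inv_one_add_sq.comp_mul_left' (inv_ne_zero hm.ne')).const_mul (m ^ 2)⁻¹
  refine h.congr (Eventually.of_forall fun t => ?_)
  simp only []
  rw [← mul_inv, one_div]
  congr 1
  field_simp
  ring

lemma integral_one_div_sq_add_sq {m : ℝ} (hm : 0 < m) :
    ∫ t : ℝ, 1 / (t ^ 2 + m ^ 2) = π / m := by
  have h := Measure.integral_comp_mul_left (fun t : ℝ => (1 + t ^ 2)⁻¹) m⁻¹
  rw [integral_univ_inv_one_add_sq, inv_inv, abs_of_pos hm, smul_eq_mul] at h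
  have h2 : ∀ t : ℝ, 1 / (t ^ 2 + m ^ 2) = (m ^ 2)⁻¹ * (1 + (m⁻¹ * t) ^ 2)⁻¹ := fun t => by
    rw [← mul_inv, one_div]
    congr 1
    field_simp
    ring
  simp_rw [h2]
  rw [integral_const_mul, h]
  field_simp

/-- The integrand decreases in `a` and `b`; the diagonal case is an arctangent integral. This lets
the integral pass to the limit of the mean iteration. -/
lemma gaussI_bounds {a b m M : ℝ} (hm : 0 < m) (ha : a ∈ Icc m M) (hb : b ∈ Icc m M) :
    π / M ≤ gaussI a b ∧ gaussI a b ≤ π / m := by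
  obtain ⟨ha1, ha2⟩ := ha
  obtain ⟨hb1, hb2⟩ := hb
  have hM : 0 < M := by linarith
  have ha0 : 0 < a := by linarith
  have hb0 : 0 < b := by linarith
  have lower : ∀ t : ℝ, 1 / (t ^ 2 + M ^ 2) ≤ 1 / √((t ^ 2 + a ^ 2) * (t ^ 2 + b ^ 2)) := by
    intro t
    refine one_div_le_one_div_of_le (by positivity) ?_
    rw [← sqrt_sq (by positivity : 0 ≤ t ^ 2 + M ^ 2), sq (t ^ 2 + M ^ 2)]
    gcongr
  have upper : ∀ t : ℝ, 1 / √((t ^ 2 + a ^ 2) * (t ^ 2 + b ^ 2)) ≤ 1 / (t ^ 2 + m ^ 2) := by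
    intro t
    refine one_div_le_one_div_of_le (by positivity) ?_
    rw [← sqrt_sq (by positivity : 0 ≤ t ^ 2 + m ^ 2), sq (t ^ 2 + m ^ 2)]
    gcongr
  have hi : Integrable fun t : ℝ => 1 / √((t ^ 2 + a ^ 2) * (t ^ 2 + b ^ 2)) := by
    refine (integrable_one_div_sq_add_sq hm).mono' ?_ (Eventually.of_forall fun t => ?_)
    · refine Continuous.aestronglyMeasurable (continuous_const.div (by fun_prop) fun t => ?_)
      positivity
    · rw [norm_of_nonneg (by positivity)]
      exact upper t
  rw [← integral_one_div_sq_add_sq hm, ← integral_one_div_sq_add_sq hM]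
  exact ⟨integral_mono (integrable_one_div_sq_add_sq hM) hi lower,
    integral_mono hi (integrable_one_div_sq_add_sq hm) upper⟩

/-- If the arithmetic-geometric mean of `a 0` and `b 0` is `1`, the elliptic integral is `π`. -/
lemma gaussI_eq_pi {a b : ℕ → ℝ} (ha : ∀ n, 0 < a n) (hb : ∀ n, 0 < b n)
    (hab : ∀ n, 2 * a (n + 1) = a n + b n) (hab' : ∀ n, b (n + 1) ^ 2 = a n * b n)
    (la : Tendsto a atTop (𝓝 1)) (lb : Tendsto b atTop (𝓝 1)) : gaussI (a 0) (b 0) = π := by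
  have hI : ∀ n, gaussI (a n) (b n) = gaussI (a 0) (b 0) := by
    intro n
    induction n with
    | zero => rfl
    | succ n ih => rw [gaussI_agm (ha n) (hb n) (hab n) (hab' n), ih]
  have hbd : ∀ n, π / max (a n) (b n) ≤ gaussI (a 0) (b 0) ∧
      gaussI (a 0) (b 0) ≤ π / min (a n) (b n) := fun n => by
    rw [← hI n]
    exact gaussI_bounds (lt_min (ha n) (hb n)) ⟨min_le_left _ _, le_max_left _ _⟩
      ⟨min_le_right _ _, le_max_right _ _⟩
  have l1 : Tendsto (fun n => π / max (a n) (b n)) atTop (𝓝 π) := by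
    simpa [Pi.div_def] using tendsto_const_nhds.div (la.max lb) (by simp)
  have l2 : Tendsto (fun n => π / min (a n) (b n)) atTop (𝓝 π) := by
    simpa [Pi.div_def] using tendsto_const_nhds.div (la.min lb) (by simp)
  exact le_antisymm (ge_of_tendsto' l2 fun n => (hbd n).2) (le_of_tendsto' l1 fun n => (hbd n).1)

/-- The lemniscatic integral. -/
lemma integral_one_div_sqrt_pow_four {c : ℝ} (hc : 0 < c) :
    ∫ x in Ioi (0 : ℝ), 1 / √(x ^ 4 + c) =
      Gamma (1 / 4) * Gamma (5 / 4) / √π * c ^ (-(1 / 4) : ℝ) := by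
  set μ : Measure ℝ := volume.restrict (Ioi 0)
  -- Fubini: integrating in `t` first gives `√π / √(x⁴ + c)`, integrating in `x` first leaves a
  -- Gamma integral in `t`.
  set F : ℝ → ℝ → ℝ := fun t x => t ^ (-(1 / 2) : ℝ) * exp (-(t * (x ^ 4 + c))) with hF
  have hx : ∀ x, ∫ t, F t x ∂μ = √π * (1 / √(x ^ 4 + c)) := by
    intro x
    have hpos : 0 < x ^ 4 + c := by positivity
    have h := integral_rpow_mul_exp_neg_mul_Ioi (a := 1 / 2) (by norm_num) hpos
    rw [show (1 / 2 - 1 : ℝ) = -(1 / 2) by norm_num, Gamma_one_half_eq,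
      ← sqrt_eq_rpow, sqrt_div zero_le_one, sqrt_one] at h
    rw [mul_comm, ← h]
    simp only [hF, mul_comm (x ^ 4 + c), μ]
  have ht : ∀ t ∈ Ioi (0 : ℝ), ∫ x, F t x ∂μ =
      Gamma (5 / 4) * (t ^ (1 / 4 - 1 : ℝ) * exp (-(c * t))) := by
    intro t ht
    have ht : 0 < t := ht
    have h := integral_exp_neg_mul_rpow (p := 4) (by norm_num) ht
    have h1 : ∀ x : ℝ, F t x = t ^ (-(1 / 2) : ℝ) * exp (-(c * t)) * exp (-t * x ^ (4 : ℝ)) := by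
      intro x
      simp only [hF]
      rw [mul_assoc, ← exp_add]
      norm_cast
      ring_nf
    simp_rw [h1]
    rw [integral_const_mul, h, show (1 / 4 - 1 : ℝ) = -(1 / 2) + -1 / 4 by norm_num,
      rpow_add ht, show (1 / 4 + 1 : ℝ) = 5 / 4 by norm_num]
    ring
  have hG1 : 0 < Gamma (1 / 4) := Gamma_pos_of_pos (by norm_num)
  have hG5 : 0 < Gamma (5 / 4) := Gamma_pos_of_pos (by norm_num)
  have hval := integral_rpow_mul_exp_neg_mul_Ioi (a := 1 / 4) (by norm_num) hc
  have hint : Integrable (Function.uncurry F) (μ.prod μ) := by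
    have hm : AEStronglyMeasurable (Function.uncurry F) (μ.prod μ) := by
      refine Measurable.aestronglyMeasurable ?_
      simp only [hF, Function.uncurry_def]
      fun_prop
    rw [integrable_prod_iff hm]
    constructor
    · filter_upwards [ae_restrict_mem measurableSet_Ioi] with t ht'
      have ht0 : 0 < t := ht'
      -- A non-integrable function has integral `0` by convention, so a nonzero value proves
      -- integrability.
      refine Integrable.of_integral_ne_zero (f := fun x => F t x) ?_
      rw [ht t ht']
      positivity
    · have h2 : Integrable (fun t => Gamma (5 / 4) * (t ^ (1 / 4 - 1 : ℝ) * exp (-(c * t)))) μ := by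
        refine (Integrable.of_integral_ne_zero ?_).const_mul _
        rw [hval]; positivity
      refine h2.congr ?_
      filter_upwards [ae_restrict_mem measurableSet_Ioi] with t ht'
      have ht0 : 0 < t := ht'
      rw [← ht t ht']
      congr 1 with x
      simp only [Function.uncurry, hF]
      rw [norm_of_nonneg (by positivity)]
  have hsw := integral_integral_swap hint
  have h3 : ∫ t, ∫ x, F t x ∂μ ∂μ = Gamma (5 / 4) * ((1 / c) ^ (1 / 4 : ℝ) * Gamma (1 / 4)) := by
    rw [← hval, ← integral_const_mul]
    exact setIntegral_congr_fun measurableSet_Ioi ht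
  rw [h3] at hsw
  simp_rw [hx] at hsw
  rw [integral_const_mul, one_div c, inv_rpow hc.le, ← rpow_neg hc.le] at hsw
  have : √π ≠ 0 := by positivity
  field_simp
  linear_combination -hsw

/-! ### The value of the theta function at `1` -/

lemma hasSum_of_range_union {α β γ : Type*} {f : β → ℝ} {g : α → β} {h : γ → β} {a b : ℝ}
    (hg : g.Injective) (hh : h.Injective) (hd : ∀ x y, g x ≠ h y)
    (hc : ∀ z, (∃ x, g x = z) ∨ ∃ y, h y = z)
    (ha : HasSum (f ∘ g) a) (hb : HasSum (f ∘ h) b) : HasSum f (a + b) := by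
  refine (hg.hasSum_range_iff.mpr ha).add_isCompl ⟨?_, ?_⟩ (hh.hasSum_range_iff.mpr hb)
  · rw [Set.disjoint_left]
    rintro _ ⟨x, rfl⟩ ⟨y, hy⟩
    exact hd x y hy.symm
  · exact codisjoint_iff.mpr (eq_univ_of_forall hc)

lemma hasSum_theta_odd {x : ℝ} (hx : 0 < x) :
    HasSum (fun n : ℤ => exp (-π * (2 * (n : ℝ) + 1) ^ 2 * x)) (theta x - theta (4 * x)) := by
  have hinj : Function.Injective fun n : ℤ => 2 * n := fun a b h => by simpa using h
  have hinj' : Function.Injective fun n : ℤ => 2 * n + 1 := fun a b h => by simpa using h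
  have hodd : Summable (fun n : ℤ => exp (-π * (2 * (n : ℝ) + 1) ^ 2 * x)) := by
    refine ((hasSum_theta hx).summable.comp_injective hinj').congr fun n => ?_
    simp
  have heven : HasSum ((fun n : ℤ => exp (-π * (n : ℝ) ^ 2 * x)) ∘ fun n : ℤ => 2 * n)
      (theta (4 * x)) := by
    refine (hasSum_theta (by linarith : 0 < 4 * x)).congr_fun fun n => ?_
    simp only [Function.comp]
    push_cast; ring_nf
  obtain ⟨o, ho⟩ := hodd
  have h := hasSum_of_range_union hinj hinj' (fun a b => by omega) (fun z => by
      rcases Int.even_or_odd' z with ⟨k, rfl | rfl⟩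
      exacts [Or.inl ⟨k, rfl⟩, Or.inr ⟨k, rfl⟩]) heven
    (ho.congr_fun fun n => by simp)
  rw [(hasSum_theta hx).unique h, add_sub_cancel_left]
  exact ho

lemma hasSum_mul_real {f g : ℤ → ℝ} {a b : ℝ} (hf0 : ∀ n, 0 ≤ f n) (hg0 : ∀ n, 0 ≤ g n)
    (hf : HasSum f a) (hg : HasSum g b) :
    HasSum (fun z : ℤ × ℤ => f z.1 * g z.2) (a * b) :=
  hf.mul hg (hf.summable.mul_of_nonneg hg.summable hf0 hg0)

/-- Split `ℤ²` by the parity of `m + n`. Points `(a + b, a - b)` have norm `2(a² + b²)`, and points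
`(a + b + 1, a - b)` have norm `((2a+1)² + (2b+1)²)/2`. -/
lemma theta_two_mul_sq {x : ℝ} (hx : 0 < x) :
    theta (2 * x) ^ 2 = theta (4 * x) ^ 2 + (theta x - theta (4 * x)) ^ 2 := by
  have h1 := hasSum_mul_real (fun _ => (exp_pos _).le) (fun _ => (exp_pos _).le)
    (hasSum_theta (by linarith : 0 < 2 * x)) (hasSum_theta (by linarith : 0 < 2 * x))
  have h2 := hasSum_mul_real (fun _ => (exp_pos _).le) (fun _ => (exp_pos _).le)
    (hasSum_theta (by linarith : 0 < 4 * x)) (hasSum_theta (by linarith : 0 < 4 * x))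
  have h3 := hasSum_mul_real (fun _ => (exp_pos _).le) (fun _ => (exp_pos _).le)
    (hasSum_theta_odd hx) (hasSum_theta_odd hx)
  have hc : ∀ z : ℤ × ℤ, (∃ x : ℤ × ℤ, (x.1 + x.2, x.1 - x.2) = z) ∨
      ∃ y : ℤ × ℤ, (y.1 + y.2 + 1, y.1 - y.2) = z := by
    rintro ⟨m, n⟩
    rcases Int.even_or_odd' (m + n) with ⟨k, hk | hk⟩
    · exact Or.inl ⟨(k, m - k), by simp only [Prod.mk.injEq]; omega⟩
    · exact Or.inr ⟨(k, m - k - 1), by simp only [Prod.mk.injEq]; omega⟩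
  have h := hasSum_of_range_union
    (f := fun z : ℤ × ℤ => exp (-π * (z.1 : ℝ) ^ 2 * (2 * x)) * exp (-π * (z.2 : ℝ) ^ 2 * (2 * x)))
    (g := fun z : ℤ × ℤ => (z.1 + z.2, z.1 - z.2))
    (h := fun z : ℤ × ℤ => (z.1 + z.2 + 1, z.1 - z.2))
    (fun a b hab => by simp only [Prod.mk.injEq] at hab; ext <;> omega)
    (fun a b hab => by simp only [Prod.mk.injEq] at hab; ext <;> omega)
    (fun a b hab => by simp only [Prod.mk.injEq] at hab; omega) hc
    (h2.congr_fun fun z => by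
      simp only [Function.comp, ← exp_add]; push_cast; ring_nf)
    (h3.congr_fun fun z => by
      simp only [Function.comp, ← exp_add]; push_cast; ring_nf)
  rw [sq, sq, sq, h1.unique h]

/-- The alternating theta function `∑_{n ∈ ℤ} (-1)^n exp(-n² π x)`. -/
noncomputable def theta4 (x : ℝ) : ℝ := 2 * theta (4 * x) - theta x

/-- The arithmetic half of the mean step; `theta_mul_theta4` is the geometric half, obtained from it
by expanding `(theta x + theta4 x)²`. -/
lemma theta_sq_add_theta4_sq {x : ℝ} (hx : 0 < x) :
    theta x ^ 2 + theta4 x ^ 2 = 2 * theta (2 * x) ^ 2 := by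
  rw [theta_two_mul_sq hx, theta4]; ring

lemma theta_mul_theta4 {x : ℝ} (hx : 0 < x) : theta x * theta4 x = theta4 (2 * x) ^ 2 := by
  have h1 := theta_sq_add_theta4_sq hx
  have h2 := theta_sq_add_theta4_sq (by linarith : 0 < 2 * x)
  have h3 : theta x + theta4 x = 2 * theta (4 * x) := by rw [theta4]; ring
  rw [show 2 * (2 * x) = 4 * x by ring] at h2
  linear_combination (1 / 2) * (theta x + theta4 x + 2 * theta (4 * x)) * h3 - (1 / 2) * h1 - h2

/-- The modular transformation at the fixed point. -/
lemma theta4_one_pow_four : 2 * theta4 1 ^ 4 = theta 1 ^ 4 := by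
  have h1 := theta_sq_add_theta4_sq one_pos
  have h2 := theta_sq_add_theta4_sq (x := 1 / 2) (by norm_num)
  -- Expressing the values at `1/2` through those at `1` gives `θ₄⁴ = (θ² + θ₄²)(θ² - θ₄²)` at `1`.
  have h3 := theta_mul_theta4 (x := 1 / 2) (by norm_num)
  have h4 : theta (1 / 2) ^ 2 = 2 * theta 2 ^ 2 := by
    rw [theta_one_div two_pos, mul_pow, ← sqrt_eq_rpow, sq_sqrt two_pos.le]
  norm_num at h1 h2 h3
  norm_num at h4
  have h5 : theta4 1 ^ 4 = theta (1 / 2) ^ 2 * theta4 (1 / 2) ^ 2 := by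
    rw [← mul_pow, h3]; ring
  have h6 : theta (1 / 2) ^ 2 = theta 1 ^ 2 + theta4 1 ^ 2 := by rw [h4, h1]
  have h7 : theta4 (1 / 2) ^ 2 = theta 1 ^ 2 - theta4 1 ^ 2 := by linarith
  rw [h6, h7] at h5
  linear_combination h5

lemma tendsto_theta : Tendsto theta atTop (𝓝 1) := by
  have h : Tendsto (psiK 0) atTop (𝓝 0) := by
    refine squeeze_zero' (Eventually.of_forall (psiK_nonneg 0))
      ((eventually_ge_atTop 1).mono fun x hx => psiK_le 0 hx) ?_
    simpa using tendsto_exp_neg_atTop_nhds_zero.const_mul (exp 1 * psiK 0 1)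
  have heq : theta = fun x => 1 + 2 * psiK 0 x := by
    funext x
    rw [theta, psi_eq_psiK]
  rw [heq]
  simpa using (h.const_mul 2).const_add 1

lemma tendsto_theta4 : Tendsto theta4 atTop (𝓝 1) := by
  have h := ((tendsto_theta.comp (tendsto_id.const_mul_atTop (by norm_num : (0 : ℝ) < 4))).const_mul
    2).sub tendsto_theta
  convert! h using 2
  norm_num

lemma gaussI_theta : gaussI (theta 1 ^ 2) (theta4 1 ^ 2) = π := by
  have hp : ∀ n : ℕ, (0 : ℝ) < 2 ^ n := fun n => by positivity
  -- Only squares of `theta4` enter the mean, so nonvanishing suffices; the product identity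
  -- propagates it under doubling.
  have h4 : ∀ n : ℕ, theta4 (2 ^ n) ≠ 0 := by
    intro n
    induction n with
    | zero =>
      intro h
      have := theta4_one_pow_four
      rw [pow_zero] at h
      rw [h] at this
      have := pow_pos (theta_pos 1) 4
      linarith
    | succ n ih =>
      intro h
      have := theta_mul_theta4 (hp n)
      rw [← pow_succ', h, zero_pow two_ne_zero] at this
      exact (mul_ne_zero (theta_pos _).ne' ih) this
  have hl : Tendsto (fun n : ℕ => (2 : ℝ) ^ n) atTop atTop :=
    tendsto_pow_atTop_atTop_of_one_lt one_lt_two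
  have := gaussI_eq_pi (a := fun n => theta (2 ^ n) ^ 2) (b := fun n => theta4 (2 ^ n) ^ 2)
    (fun n => pow_pos (theta_pos _) 2) (fun n => by have := h4 n; positivity)
    (fun n => by simp only [pow_succ' (2 : ℝ) n, theta_sq_add_theta4_sq (hp n)])
    (fun n => by simp only [pow_succ' (2 : ℝ) n]; rw [← theta_mul_theta4 (hp n), mul_pow])
    (by simpa using (tendsto_theta.comp hl).pow 2) (by simpa using (tendsto_theta4.comp hl).pow 2)
  simpa using this

theorem theta_one : theta 1 = π ^ (1 / 4 : ℝ) / Gamma (3 / 4) := by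
  have h1 := gaussI_theta
  have hA := theta_pos 1
  have hG1 : 0 < Gamma (1 / 4) := Gamma_pos_of_pos (by norm_num)
  have hG3 : 0 < Gamma (3 / 4) := Gamma_pos_of_pos (by norm_num)
  set A := theta 1 with hAdef
  -- Because `theta4 1 ^ 4 = A⁴/2`, this is the substituted form with `s = 0` and `p = A⁴`: the
  -- middle term of the quartic disappears and the lemniscatic integral of `x⁴ + A⁸` remains.
  have h2 : ∀ t : ℝ, (t ^ 2 + (A ^ 2) ^ 2) * (t ^ 2 + (theta4 1 ^ 2) ^ 2) =
      (t ^ 2 + (0 + 2 * (A ^ 4 / 1)) / 4) * (t ^ 2 + A ^ 4) := fun t => by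
    have := theta4_one_pow_four
    rw [show (theta4 1 ^ 2) ^ 2 = A ^ 4 / 2 by rw [hAdef]; linarith]; ring
  simp only [gaussI, h2, div_one] at h1
  rw [integral_ellipticK_subst 0 (pow_pos hA 4)] at h1
  simp only [zero_mul, add_zero] at h1
  rw [integral_one_div_sqrt_pow_four (by positivity)] at h1
  have h3 : ((A ^ 4) ^ 2) ^ (-(1 / 4) : ℝ) = (A ^ 2)⁻¹ := by
    rw [← pow_mul, ← rpow_natCast, ← rpow_mul hA.le, ← rpow_natCast A 2, ← rpow_neg hA.le]
    norm_num
  have h4 : Gamma (5 / 4) = 1 / 4 * Gamma (1 / 4) := by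
    rw [← Gamma_add_one (by norm_num)]; norm_num
  have h5 : Gamma (1 / 4) * Gamma (3 / 4) = π * √2 := by
    have := Real.Gamma_mul_Gamma_one_sub (1 / 4)
    rw [show (1 - 1 / 4 : ℝ) = 3 / 4 by norm_num, show π * (1 / 4) = π / 4 by ring,
      sin_pi_div_four] at this
    rw [this]
    have := sq_sqrt (zero_le_two (α := ℝ))
    field_simp
    linarith
  rw [h3, h4] at h1
  have hsp : 0 < √π := sqrt_pos.mpr pi_pos
  have hsp2 : √π ^ 2 = π := sq_sqrt pi_pos.le
  have h6 : (A * Gamma (3 / 4)) ^ 2 = √π := by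
    have h7 : Gamma (1 / 4) ^ 2 = 2 * π * √π * A ^ 2 := by
      field_simp at h1
      linarith
    have h8 : (Gamma (1 / 4) * Gamma (3 / 4)) ^ 2 = 2 * π ^ 2 := by
      rw [h5, mul_pow, sq_sqrt two_pos.le]; ring
    rw [mul_pow, h7] at h8
    have h9 : √π * (A * Gamma (3 / 4)) ^ 2 = √π * √π := by
      rw [← sq √π, hsp2]
      have := pi_pos.ne'
      refine mul_left_cancel₀ (mul_ne_zero two_ne_zero this) ?_
      linear_combination h8
    exact mul_left_cancel₀ hsp.ne' h9
  rw [eq_div_iff hG3.ne', ← sqrt_sq (mul_pos hA hG3).le, h6, sqrt_eq_rpow, sqrt_eq_rpow,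
    ← rpow_mul pi_pos.le]
  norm_num

lemma psi_one : psi 1 = 1 / 2 * (π ^ (1 / 4 : ℝ) / Gamma (3 / 4) - 1) := by
  rw [← theta_one, theta]; ring

/-! ### Numerical bounds -/

lemma exp_neg_pi_bounds : 0.04321387 < exp (-π) ∧ exp (-π) < 0.04321396 := by
  have h1 : ∀ x : ℝ, exp (4 * x) = exp x ^ 4 := fun x => by
    rw [← exp_nat_mul]; norm_num
  -- The Taylor bound needs an argument of modulus at most `1`, so `exp (-π / 4)` is bracketed and
  -- raised to the fourth power.
  have hb1 := Real.exp_bound (x := -0.785398) (n := 12) (by norm_num [abs_le]) (by norm_num)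
  have hb2 := Real.exp_bound (x := -0.78539825) (n := 12) (by norm_num [abs_le]) (by norm_num)
  rw [abs_le] at hb1 hb2
  norm_num [Finset.sum_range_succ, Nat.factorial] at hb1 hb2
  constructor
  · have h3 : exp (4 * (-0.78539825)) < exp (-π) := by
      rw [exp_lt_exp]; linarith [pi_lt_d6]
    refine lt_trans ?_ h3
    rw [h1]
    have h4 : (0.45593808 : ℝ) ≤ exp (-0.78539825) := by norm_num; linarith [hb2.1]
    calc (0.04321387 : ℝ) < 0.45593808 ^ 4 := by norm_num
      _ ≤ _ := by gcongr
  · have h3 : exp (-π) < exp (4 * (-0.785398)) := by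
      rw [exp_lt_exp]; linarith [pi_gt_d6]
    refine lt_trans h3 ?_
    rw [h1]
    have h4 : exp (-0.785398) ≤ 0.45593822 := by norm_num; linarith [hb1.2]
    calc exp (-0.785398) ^ 4 ≤ 0.45593822 ^ 4 := by gcongr
      _ < _ := by norm_num

lemma hasSum_psiK_one (k : ℕ) : HasSum (fun n : ℕ =>
    (((n : ℝ) + 1) ^ 2 * π) ^ k * exp (-π) ^ ((n + 1) ^ 2)) (psiK k 1) := by
  refine (summable_psiK k one_pos).hasSum.congr_fun fun n => ?_
  rw [← exp_nat_mul]
  push_cast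
  ring_nf

lemma psiK_one_lower (k : ℕ) :
    π ^ k * (exp (-π) + 4 ^ k * exp (-π) ^ 4) ≤ psiK k 1 := by
  have h := (hasSum_psiK_one k).summable.sum_le_tsum (Finset.range 2) fun n _ => by positivity
  rw [(hasSum_psiK_one k).tsum_eq] at h
  refine le_trans (le_of_eq ?_) h
  norm_num [Finset.sum_range_succ, mul_pow]
  ring

/-- From the third term on, weights are at most `81 * 4 ^ n` while the exponentials shrink at least
as fast as `(1/8) ^ n`. The tail is below a geometric series of ratio `1/2`, whence `162 = 2 * 81`.
-/
lemma psiK_one_upper {k : ℕ} (hk : k ≤ 2) :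
    psiK k 1 ≤ π ^ k * (exp (-π) + 4 ^ k * exp (-π) ^ 4 + 162 * exp (-π) ^ 9) := by
  have hE0 := exp_pos (-π)
  have hE : exp (-π) ≤ 1 / 8 := by linarith [exp_neg_pi_bounds.2]
  have h := (hasSum_psiK_one k).summable.sum_add_tsum_nat_add 2
  rw [(hasSum_psiK_one k).tsum_eq] at h
  have hn : ∀ n : ℕ, ((n : ℝ) + 3) ^ 4 ≤ 81 * 4 ^ n := by
    intro n
    induction n with
    | zero => norm_num
    | succ n ih =>
      have h0 : (0 : ℝ) ≤ n := n.cast_nonneg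
      have h2 : ((n : ℝ) + 1 + 3) ^ 2 ≤ 2 * (n + 3) ^ 2 := by nlinarith
      have h3 : (((n : ℝ) + 1 + 3) ^ 2) ^ 2 ≤ (2 * (n + 3) ^ 2) ^ 2 := by gcongr
      push_cast
      rw [pow_succ 4 n]
      nlinarith
  have hterm : ∀ n : ℕ, ((((n + 2 : ℕ) : ℝ) + 1) ^ 2 * π) ^ k * exp (-π) ^ ((n + 2 + 1) ^ 2) ≤
      π ^ k * (81 * exp (-π) ^ 9) * (1 / 2) ^ n := by
    intro n
    have h0 : (0 : ℝ) ≤ n := n.cast_nonneg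
    have a1 : ((((n + 2 : ℕ) : ℝ) + 1) ^ 2 * π) ^ k ≤ π ^ k * (81 * 4 ^ n) := by
      rw [mul_pow, mul_comm, ← pow_mul]
      refine mul_le_mul_of_nonneg_left (le_trans ?_ (hn n)) (by positivity)
      push_cast
      rw [show (n : ℝ) + 2 + 1 = n + 3 by ring]
      exact pow_le_pow_right₀ (by linarith) (by omega)
    have a2 : exp (-π) ^ ((n + 2 + 1) ^ 2) ≤ exp (-π) ^ 9 * (1 / 8) ^ n := by
      calc exp (-π) ^ ((n + 2 + 1) ^ 2) ≤ exp (-π) ^ (9 + n) :=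
            pow_le_pow_of_le_one hE0.le (by linarith) (by nlinarith)
        _ = exp (-π) ^ 9 * exp (-π) ^ n := pow_add _ _ _
        _ ≤ _ := by gcongr
    calc _ ≤ π ^ k * (81 * 4 ^ n) * (exp (-π) ^ 9 * (1 / 8) ^ n) := by gcongr
      _ = π ^ k * (81 * exp (-π) ^ 9) * (4 ^ n * (1 / 8) ^ n) := by ring
      _ = _ := by rw [← mul_pow]; norm_num
  have htail := ((summable_nat_add_iff 2).mpr (hasSum_psiK_one k).summable).tsum_le_tsum hterm
    (summable_geometric_two.mul_left _)
  rw [tsum_mul_left, tsum_geometric_two] at htail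
  rw [← h]
  refine (add_le_add_right htail _).trans (le_of_eq ?_)
  norm_num [Finset.sum_range_succ, mul_pow]
  ring

lemma integral_Xi_eq : ∫ t in Ioi (0 : ℝ), Xi t = 4 * π * psiK 2 1 - 3 * π / 4 * theta 1 := by
  rw [integral_Xi, S_zero, psiK_one_one]; ring

lemma abs_integral_Xi_sub_lt : |(∫ t in Ioi (0 : ℝ), Xi t) - 2.8067| < 0.00005 := by
  obtain ⟨hE1, hE2⟩ := exp_neg_pi_bounds
  rw [integral_Xi_eq, theta, psi_eq_psiK]
  have hl2 := psiK_one_lower 2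
  have hu2 := psiK_one_upper (k := 2) le_rfl
  have hl0 := psiK_one_lower 0
  have hu0 := psiK_one_upper (k := 0) (by norm_num)
  have hp1 := pi_gt_d6
  have hp2 := pi_lt_d6
  have hE0 := exp_pos (-π)
  set E := exp (-π)
  have e4 : E ^ 4 ≤ 0.04321396 ^ 4 := by gcongr
  have e4' : 0.04321387 ^ 4 ≤ E ^ 4 := by gcongr
  have e9 : E ^ 9 ≤ 0.04321396 ^ 9 := by gcongr
  have hE9 : 0 < E ^ 9 := by positivity
  have l2 : 3.141592 ^ 2 * (0.04321387 + 4 ^ 2 * 0.04321387 ^ 4) ≤ psiK 2 1 := by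
    refine le_trans ?_ hl2
    gcongr
  have u2 : psiK 2 1 ≤ 3.141593 ^ 2 * (0.04321396 + 4 ^ 2 * 0.04321396 ^ 4 +
      162 * 0.04321396 ^ 9) := by
    refine hu2.trans ?_
    gcongr
  have l0 : 0.04321387 + 0.04321387 ^ 4 ≤ psiK 0 1 := by
    norm_num at hl0 e4' ⊢
    linarith
  have u0 : psiK 0 1 ≤ 0.04321396 + 0.04321396 ^ 4 + 162 * 0.04321396 ^ 9 := by
    norm_num at hu0 e4 e9 ⊢
    linarith
  have a1 : 3.141592 * (3.141592 ^ 2 * (0.04321387 + 4 ^ 2 * 0.04321387 ^ 4)) ≤ π * psiK 2 1 := by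
    gcongr
  have a2 : π * psiK 2 1 ≤ 3.141593 * (3.141593 ^ 2 * (0.04321396 + 4 ^ 2 * 0.04321396 ^ 4 +
      162 * 0.04321396 ^ 9)) := by
    have := psiK_nonneg 2 1
    gcongr
  have a3 : 3.141592 * (0.04321387 + 0.04321387 ^ 4) ≤ π * psiK 0 1 := by gcongr
  have a4 : π * psiK 0 1 ≤ 3.141593 * (0.04321396 + 0.04321396 ^ 4 + 162 * 0.04321396 ^ 9) := by
    have := psiK_nonneg 0 1
    gcongr
  rw [show 4 * π * psiK 2 1 - 3 * π / 4 * (1 + 2 * psiK 0 1) =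
    4 * (π * psiK 2 1) - 3 / 4 * π - 3 / 2 * (π * psiK 0 1) by ring]
  norm_num at a1 a2 a3 a4
  rw [abs_lt]
  norm_num
  constructor <;> linarith

/-! ### The value of `Ξ(0)` -/

/-- The first term of the integrand `EK (1 / 2) 0`. -/
noncomputable def gammaKernel (ω : ℝ) : ℝ := exp (1 / 2 * ω) * exp (-(π * exp (2 * ω)))

lemma gammaKernel_pos (ω : ℝ) : 0 < gammaKernel ω := by unfold gammaKernel; positivity

lemma gammaKernel_le (ω : ℝ) : gammaKernel ω ≤ EK (1 / 2) 0 ω := by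
  rw [gammaKernel, EK]
  gcongr
  have h := (summable_psiK 0 (exp_pos (2 * ω))).le_tsum 0 fun n _ => by positivity
  refine le_trans (le_of_eq ?_) h
  norm_num

/-- For `x ≥ 1`, `e^{-n²π(x-1)} ≤ e^{-π(x-1)}` in every term. The loss is tiny because `exp π * psiK
0 1` is close to `1`. -/
lemma EK_le_gammaKernel {ω : ℝ} (hω : 0 ≤ ω) :
    EK (1 / 2) 0 ω ≤ exp π * psiK 0 1 * gammaKernel ω := by
  have hx : 1 ≤ exp (2 * ω) := one_le_exp (by linarith)
  have h : psiK 0 (exp (2 * ω)) ≤ exp π * exp (-(π * exp (2 * ω))) * psiK 0 1 := by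
    rw [psiK, psiK, ← tsum_mul_left]
    refine (summable_psiK 0 (exp_pos _)).tsum_le_tsum (fun n => ?_)
      ((summable_psiK 0 one_pos).mul_left _)
    rw [pow_zero, one_mul, one_mul, ← exp_add, ← exp_add, exp_le_exp]
    have h1 : 0 ≤ (((n : ℝ) + 1) ^ 2 - 1) * π := by
      have h0 : (0 : ℝ) ≤ n := n.cast_nonneg
      exact mul_nonneg (by nlinarith) pi_pos.le
    nlinarith [mul_nonneg h1 (sub_nonneg.mpr hx)]
  rw [EK, gammaKernel]
  calc _ ≤ exp (1 / 2 * ω) * (exp π * exp (-(π * exp (2 * ω))) * psiK 0 1) := by gcongr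
    _ = _ := by ring

lemma integrableOn_gammaKernel : IntegrableOn gammaKernel (Ioi 0) := by
  refine (integrableOn_EK (1 / 2) 0).mono' ?_ (Eventually.of_forall fun ω => ?_)
  · unfold gammaKernel
    exact Continuous.aestronglyMeasurable (by fun_prop)
  · rw [norm_of_nonneg (gammaKernel_pos ω).le]
    exact gammaKernel_le ω

/-- An antiderivative of the kernel, up to a multiplicative error given by `R`. -/
lemma integral_gammaKernel_mul {R R' : ℝ → ℝ} (hR : ∀ z, π ≤ z → HasDerivAt R (R' z) z)
    (hb : ∀ z, π ≤ z → |R z| ≤ 1)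
    (hq : ∀ z, π ≤ z → 0 ≤ 2 * z * (R z - R' z) - R z / 2) :
    IntegrableOn (fun ω => gammaKernel ω * (2 * (π * exp (2 * ω)) *
      (R (π * exp (2 * ω)) - R' (π * exp (2 * ω))) - R (π * exp (2 * ω)) / 2)) (Ioi 0) ∧
    ∫ ω in Ioi (0 : ℝ), gammaKernel ω * (2 * (π * exp (2 * ω)) *
      (R (π * exp (2 * ω)) - R' (π * exp (2 * ω))) - R (π * exp (2 * ω)) / 2) =
      exp (-π) * R π := by
  have hz : ∀ ω : ℝ, 0 ≤ ω → π ≤ π * exp (2 * ω) := fun ω hω =>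
    le_mul_of_one_le_right pi_pos.le (one_le_exp (by linarith))
  -- With `z = πe^{2ω}`, the function is proportional to `z^{1/4} e^{-z} R(z)`. A weight at least
  -- (at most) `1` makes `exp (-π) * R π` an upper (lower) bound for the integral of `gammaKernel`.
  have hd : ∀ ω ∈ Ici (0 : ℝ), HasDerivAt (fun ω => -(gammaKernel ω * R (π * exp (2 * ω))))
      (gammaKernel ω * (2 * (π * exp (2 * ω)) *
      (R (π * exp (2 * ω)) - R' (π * exp (2 * ω))) - R (π * exp (2 * ω)) / 2)) ω := by
    intro ω hω
    have h1 : HasDerivAt (fun ω : ℝ => exp (1 / 2 * ω)) _ ω :=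
      ((hasDerivAt_id ω).const_mul (1 / 2)).exp
    have h2 : HasDerivAt (fun ω : ℝ => π * exp (2 * ω)) _ ω :=
      (((hasDerivAt_id ω).const_mul 2).exp).const_mul π
    have h3 := (hR _ (hz ω hω)).comp ω h2
    refine ((h1.mul h2.neg.exp).mul h3).neg.congr_deriv ?_
    simp only [gammaKernel, id, Function.comp, Pi.mul_apply, Pi.neg_apply]
    ring
  have hl : Tendsto (fun ω => -(gammaKernel ω * R (π * exp (2 * ω)))) atTop (𝓝 0) := by
    refine squeeze_zero_norm' ?_ (tendsto_EK (1 / 2) 0)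
    filter_upwards [eventually_ge_atTop 0] with ω hω
    rw [norm_neg, norm_mul, norm_of_nonneg (gammaKernel_pos ω).le]
    exact (mul_le_of_le_one_right (gammaKernel_pos ω).le (hb _ (hz ω hω))).trans
      (gammaKernel_le ω)
  have hn : ∀ ω ∈ Ioi (0 : ℝ), 0 ≤ gammaKernel ω * (2 * (π * exp (2 * ω)) *
      (R (π * exp (2 * ω)) - R' (π * exp (2 * ω))) - R (π * exp (2 * ω)) / 2) := fun ω hω =>
    mul_nonneg (gammaKernel_pos ω).le (hq _ (hz ω (le_of_lt hω)))
  refine ⟨integrableOn_Ioi_deriv_of_nonneg' hd hn hl, ?_⟩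
  rw [integral_Ioi_of_hasDerivAt_of_nonneg' hd hn hl]
  simp [gammaKernel]

/-- The rational function is half of a convergent of the continued fraction `1/(z + (3/4)/(1 + 1/(z
+ (7/4)/(1 + 2/(z + ⋯)))))` of the incomplete Gamma function `Γ(1/4, z)`, stopped after the `2`.
Stopping after the `7/4` gives the lower bound in `le_integral_gammaKernel`. -/
lemma integral_gammaKernel_le : ∫ ω in Ioi (0 : ℝ), gammaKernel ω ≤ exp (-π) *
    ((π ^ 2 + 19 / 4 * π + 2) / (2 * (π * (π ^ 2 + 11 / 2 * π + 77 / 16)))) := by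
  have hR : ∀ z, π ≤ z → HasDerivAt
      (fun z : ℝ => (z ^ 2 + 19 / 4 * z + 2) / (2 * (z * (z ^ 2 + 11 / 2 * z + 77 / 16))))
      (((2 * z + 19 / 4) * (2 * (z * (z ^ 2 + 11 / 2 * z + 77 / 16))) -
        (z ^ 2 + 19 / 4 * z + 2) * (2 * (3 * z ^ 2 + 11 * z + 77 / 16))) /
        (2 * (z * (z ^ 2 + 11 / 2 * z + 77 / 16))) ^ 2) z := by
    intro z hz
    have hz0 : 0 < z := pi_pos.trans_le hz
    have h := hasDerivAt_id z
    refine HasDerivAt.div ?_ ?_ (by positivity)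
    · exact (((h.pow 2).add (h.const_mul (19 / 4))).add_const 2).congr_deriv (by simp)
    · exact ((h.mul (((h.pow 2).add (h.const_mul (11 / 2))).add_const
        (77 / 16))).const_mul 2).congr_deriv (by simp; ring)
  have hq : ∀ z : ℝ, π ≤ z → 1 ≤ 2 * z *
      ((z ^ 2 + 19 / 4 * z + 2) / (2 * (z * (z ^ 2 + 11 / 2 * z + 77 / 16))) -
      (((2 * z + 19 / 4) * (2 * (z * (z ^ 2 + 11 / 2 * z + 77 / 16))) -
        (z ^ 2 + 19 / 4 * z + 2) * (2 * (3 * z ^ 2 + 11 * z + 77 / 16))) /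
        (2 * (z * (z ^ 2 + 11 / 2 * z + 77 / 16))) ^ 2)) -
      (z ^ 2 + 19 / 4 * z + 2) / (2 * (z * (z ^ 2 + 11 / 2 * z + 77 / 16))) / 2 := by
    intro z hz
    have hz0 : 0 < z := pi_pos.trans_le hz
    -- After clearing denominators only nonnegative coefficients in `z` remain.
    rw [← sub_nonneg]
    field_simp
    ring_nf
    positivity
  obtain ⟨hi, he⟩ := integral_gammaKernel_mul hR (fun z hz => by
    have hz0 : 3 < z := pi_gt_three.trans_le hz
    rw [abs_of_nonneg (by positivity), div_le_one (by positivity)]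
    nlinarith [mul_pos (by linarith : 0 < z) (by linarith : 0 < z), pow_pos (by linarith : 0 < z) 3])
    (fun z hz => zero_le_one.trans (hq z hz))
  rw [← he]
  refine setIntegral_mono_on integrableOn_gammaKernel hi measurableSet_Ioi fun ω hω => ?_
  exact le_mul_of_one_le_right (gammaKernel_pos ω).le
    (hq _ (le_mul_of_one_le_right pi_pos.le (one_le_exp (by linarith [hω.out]))))

lemma le_integral_gammaKernel : exp (-π) * ((π + 11 / 4) / (2 * (π ^ 2 + 7 / 2 * π + 21 / 16))) ≤
    ∫ ω in Ioi (0 : ℝ), gammaKernel ω := by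
  have hR : ∀ z, π ≤ z → HasDerivAt
      (fun z : ℝ => (z + 11 / 4) / (2 * (z ^ 2 + 7 / 2 * z + 21 / 16)))
      ((1 * (2 * (z ^ 2 + 7 / 2 * z + 21 / 16)) - (z + 11 / 4) * (2 * (2 * z + 7 / 2))) /
        (2 * (z ^ 2 + 7 / 2 * z + 21 / 16)) ^ 2) z := by
    intro z hz
    have hz0 : 0 < z := pi_pos.trans_le hz
    have h := hasDerivAt_id z
    refine HasDerivAt.div (h.add_const _) ?_ (by positivity)
    exact ((((h.pow 2).add (h.const_mul (7 / 2))).add_const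
        (21 / 16)).const_mul 2).congr_deriv (by simp)
  have hq : ∀ z : ℝ, π ≤ z → 2 * z * ((z + 11 / 4) / (2 * (z ^ 2 + 7 / 2 * z + 21 / 16)) -
      ((1 * (2 * (z ^ 2 + 7 / 2 * z + 21 / 16)) - (z + 11 / 4) * (2 * (2 * z + 7 / 2))) /
        (2 * (z ^ 2 + 7 / 2 * z + 21 / 16)) ^ 2)) -
      (z + 11 / 4) / (2 * (z ^ 2 + 7 / 2 * z + 21 / 16)) / 2 ≤ 1 := by
    intro z hz
    have hz0 : 0 < z := pi_pos.trans_le hz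
    rw [← sub_nonneg]
    field_simp
    ring_nf
    positivity
  have hq0 : ∀ z : ℝ, π ≤ z → 0 ≤ 2 * z * ((z + 11 / 4) / (2 * (z ^ 2 + 7 / 2 * z + 21 / 16)) -
      ((1 * (2 * (z ^ 2 + 7 / 2 * z + 21 / 16)) - (z + 11 / 4) * (2 * (2 * z + 7 / 2))) /
        (2 * (z ^ 2 + 7 / 2 * z + 21 / 16)) ^ 2)) -
      (z + 11 / 4) / (2 * (z ^ 2 + 7 / 2 * z + 21 / 16)) / 2 := by
    intro z hz
    have hz0 : 3 < z := pi_gt_three.trans_le hz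
    -- Shifting by `3 < π` leaves an expression whose positivity is visible from its coefficients in
    -- `y`.
    obtain ⟨y, rfl⟩ : ∃ y, z = y + 3 := ⟨z - 3, by ring⟩
    have hy : 0 < y := by linarith
    field_simp
    ring_nf
    positivity
  obtain ⟨hi, he⟩ := integral_gammaKernel_mul hR (fun z hz => by
    have hz0 : 3 < z := pi_gt_three.trans_le hz
    rw [abs_of_nonneg (by positivity), div_le_one (by positivity)]
    nlinarith) hq0
  rw [← he]
  refine setIntegral_mono_on hi integrableOn_gammaKernel measurableSet_Ioi fun ω hω => ?_
  exact mul_le_of_le_one_right (gammaKernel_pos ω).le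
    (hq _ (le_mul_of_one_le_right pi_pos.le (one_le_exp (by linarith [hω.out]))))

lemma Xi_zero : Xi 0 = 1 / 2 - 1 / 2 * ∫ ω in Ioi (0 : ℝ), EK (1 / 2) 0 ω := by
  rw [Xi_eq]
  simp only [mul_zero, cos_zero, mul_one]
  ring

lemma Xi_zero_lt : Xi 0 < 0.4972 := by
  have h := le_integral_gammaKernel.trans (integral_mono integrableOn_gammaKernel
    (integrableOn_EK (1 / 2) 0) gammaKernel_le)
  have hp1 := pi_gt_d6
  have hp2 := pi_lt_d6
  have h1 : 0.13 ≤ (π + 11 / 4) / (2 * (π ^ 2 + 7 / 2 * π + 21 / 16)) := by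
    rw [le_div_iff₀ (by positivity)]
    nlinarith
  have hE := exp_neg_pi_bounds.1
  have h2 : 0.04321387 * 0.13 ≤
      exp (-π) * ((π + 11 / 4) / (2 * (π ^ 2 + 7 / 2 * π + 21 / 16))) := by
    gcongr
  rw [Xi_zero]
  linarith

lemma le_Xi_zero : 0.4971 ≤ Xi 0 := by
  have h1 : ∫ ω in Ioi (0 : ℝ), EK (1 / 2) 0 ω ≤
      ∫ ω in Ioi (0 : ℝ), exp π * psiK 0 1 * gammaKernel ω :=
    setIntegral_mono_on (integrableOn_EK _ _) (integrableOn_gammaKernel.const_mul _)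
      measurableSet_Ioi fun ω hω => EK_le_gammaKernel (le_of_lt hω)
  have h0 := psiK_nonneg 0 1
  have h2 : exp π * psiK 0 1 * ∫ ω in Ioi (0 : ℝ), gammaKernel ω ≤ exp π * psiK 0 1 * (exp (-π) *
      ((π ^ 2 + 19 / 4 * π + 2) / (2 * (π * (π ^ 2 + 11 / 2 * π + 77 / 16))))) := by
    gcongr
    exact integral_gammaKernel_le
  have h3 : exp π * exp (-π) = 1 := by rw [← exp_add]; simp
  have hp1 := pi_gt_d6
  have hp2 := pi_lt_d6
  have h4 : (π ^ 2 + 19 / 4 * π + 2) / (2 * (π * (π ^ 2 + 11 / 2 * π + 77 / 16))) ≤ 0.1338 := by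
    rw [div_le_iff₀ (by positivity)]
    have : 3.1415 * (3.1415 ^ 2 + 11 / 2 * 3.1415 + 77 / 16) ≤
      π * (π ^ 2 + 11 / 2 * π + 77 / 16) := by gcongr <;> linarith
    nlinarith
  have hE0 := exp_pos (-π)
  have hE := exp_neg_pi_bounds.2
  have h5 : psiK 0 1 ≤ 0.04322 := by
    have hu := psiK_one_upper (k := 0) (by norm_num)
    have e4 : exp (-π) ^ 4 ≤ 0.04321396 ^ 4 := by gcongr
    have e9 : exp (-π) ^ 9 ≤ 0.04321396 ^ 9 := by gcongr
    norm_num at hu e4 e9 hE ⊢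
    linarith
  have h6 : psiK 0 1 * ((π ^ 2 + 19 / 4 * π + 2) / (2 * (π * (π ^ 2 + 11 / 2 * π + 77 / 16)))) ≤
      0.04322 * 0.1338 := by gcongr
  rw [integral_const_mul] at h1
  have h7 : exp π * psiK 0 1 * (exp (-π) *
      ((π ^ 2 + 19 / 4 * π + 2) / (2 * (π * (π ^ 2 + 11 / 2 * π + 77 / 16))))) =
      psiK 0 1 * ((π ^ 2 + 19 / 4 * π + 2) / (2 * (π * (π ^ 2 + 11 / 2 * π + 77 / 16)))) := by
    linear_combination psiK 0 1 *
      ((π ^ 2 + 19 / 4 * π + 2) / (2 * (π * (π ^ 2 + 11 / 2 * π + 77 / 16)))) * h3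
  rw [Xi_zero]
  norm_num at h6 ⊢
  linarith

end RiemannXi

theorem mainTheorem3 :
    -- `Ξ` is the (real) restriction of `ξ` to the critical line
    (∀ t : ℝ, RiemannXi.xi (1 / 2 + Complex.I * (t : ℂ)) = (RiemannXi.Xi t : ℂ)) ∧
    -- `Ξ` is the cosine transform of a positive integrable kernel
    (∀ ω : ℝ, 0 ≤ ω → 0 < RiemannXi.S ω) ∧
    IntegrableOn RiemannXi.S (Ioi 0) ∧
    (∀ t : ℝ, RiemannXi.Xi t = ∫ ω in Ioi (0 : ℝ), RiemannXi.S ω * Real.cos (ω * t)) ∧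
    -- the modulus is maximal at `t = 0`, with value `0.4971…`
    (∀ t : ℝ, |RiemannXi.Xi t| ≤ RiemannXi.Xi 0) ∧
    (0.4971 ≤ RiemannXi.Xi 0 ∧ RiemannXi.Xi 0 < 0.4972) ∧
    -- the integral of `Ξ`
    IntegrableOn RiemannXi.Xi (Ioi 0) ∧
    (∫ t in Ioi (0 : ℝ), RiemannXi.Xi t) = Real.pi / 2 * RiemannXi.S 0 ∧
    (∫ t in Ioi (0 : ℝ), RiemannXi.Xi t) =
      4 * Real.pi * (3 / 2 * deriv RiemannXi.psi 1 + deriv (deriv RiemannXi.psi) 1) ∧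
    -- the values at `1` of the theta function and of its first two derivatives
    RiemannXi.psi 1 = 1 / 2 * (Real.pi ^ (1 / 4 : ℝ) / Real.Gamma (3 / 4) - 1) ∧
    HasDerivAt RiemannXi.psi
      (-(1 / 8) * (Real.pi ^ (1 / 4 : ℝ) / Real.Gamma (3 / 4))) 1 ∧
    HasDerivAt (deriv RiemannXi.psi)
      (Real.pi ^ 2 * ∑' n : ℕ, ((n : ℝ) + 1) ^ 4 * Real.exp (-Real.pi * ((n : ℝ) + 1) ^ 2)) 1 ∧
    -- the resulting formula for the integral and its value, rounded to four decimals
    (∫ t in Ioi (0 : ℝ), RiemannXi.Xi t) =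
      4 * Real.pi ^ 3 *
          ∑' n : ℕ, ((n : ℝ) + 1) ^ 4 * Real.exp (-Real.pi * ((n : ℝ) + 1) ^ 2) -
        3 * Real.pi / 4 * (Real.pi ^ (1 / 4 : ℝ) / Real.Gamma (3 / 4)) ∧
    |(∫ t in Ioi (0 : ℝ), RiemannXi.Xi t) - 2.8067| < 0.00005 := by 
  have hint := RiemannXi.integral_Xi_eq
  refine ⟨fun t => ?_, fun ω hω => RiemannXi.S_pos hω, RiemannXi.integrableOn_S,
    RiemannXi.Xi_eq_integral, RiemannXi.abs_Xi_le, ⟨RiemannXi.le_Xi_zero, RiemannXi.Xi_zero_lt⟩,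
    RiemannXi.integrable_Xi.integrableOn, RiemannXi.integral_Xi, ?_, RiemannXi.psi_one, ?_, ?_, ?_,
    RiemannXi.abs_integral_Xi_sub_lt⟩
  · rw [RiemannXi.Xi, RiemannXi.xi_eq, Complex.ofReal_re]
  · rw [hint, RiemannXi.hasDerivAt_psi_one.deriv, (RiemannXi.hasDerivAt_deriv_psi one_pos).deriv]
    ring
  · rw [← RiemannXi.theta_one]
    exact RiemannXi.hasDerivAt_psi_one
  · rw [← RiemannXi.psiK_two_one]
    exact RiemannXi.hasDerivAt_deriv_psi one_pos
  · rw [hint, RiemannXi.psiK_two_one, ← RiemannXi.theta_one]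
    ring
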